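/- Conventions. An operator system is a unital $*$-invariant subspace $\mathcal X$ of a unital $C^*$-algebra. A state on $\mathcal X$ is a unital linear functional that is nonnegative on the elements of $\mathcal X$ that are positive in the ambient $C^*$-algebra; the state space $S(\mathcal X)$ carries the weak$^*$ topology. A slip-norm is a seminorm $L\colon\mathcal X\to[0,\infty)$ that vanishes on $\mathbb C 1$ and satisfies $L(x^*)=L(x)$. The pair $(\mathcal X,L)$ is a compact quantum metric space if $L$ is a slip-norm and the Monge–Kantorovič metric $\rho_L(\varphi,\psi)=\sup\{|\varphi(x)-\psi(x)| : x\in\mathcal X,\ L(x)\le 1\}$ metrizes the weak$^*$ topology on $S(\mathcal X)$. Let $\Gamma$ be a countable discrete group acting by $*$-automorphisms $\alpha_g$ on a unital $C^*$-algebra $A$. Let $\ell^2(\Gamma,A)$ be the right Hilbert $A$-module of families $(a_s)_{s\in\Gamma}$ for which $\sum_s a_s^*a_s$ converges in norm, and let $A\rtimes\Gamma$ be the reduced crossed product, i.e. the $C^*$-algebra of adjointable operators on $\ell^2(\Gamma,A)$ generated by the operators $\pi_\alpha(x)\lambda_g$ ($x\in A$, $g\in\Gamma$), where $\pi_\alpha(x)\lambda_g(a\delta_s)=\alpha_{gs}^{-1}(x)a\,\delta_{gs}$.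 For an operator system $\mathcal X\subseteq A$ with $\alpha_g(\mathcal X)=\mathcal X$ for all $g$, let $\mathcal X\rtimes_{\mathrm{alg}}\Gamma\subseteq A\rtimes\Gamma$ be the operator system spanned by the elements $\pi_\alpha(x)\lambda_g$ with $x\in\mathcal X$, $g\in\Gamma$. For $z=\sum_g\pi_\alpha(x_g)\lambda_g$ in it (a finite sum), put $E_g(z)=x_g$; equivalently $E_g(z)=E(z\lambda_g^{-1})$, where $E(z)=\langle\delta_e,z\delta_e\rangle$ is the canonical conditional expectation onto $A$. For $A=\mathbb C$ with the trivial action one obtains the group algebra $\mathbb C\Gamma=\mathbb C\rtimes_{\mathrm{alg}}\Gamma$ inside the reduced group $C^*$-algebra. A proper matrix length function is a map $l\colon\Gamma\to M_n(\mathbb C)$ such that every $l(g)$ is selfadjoint, $l(g)=0$ if and only if $g=e$, the map $s\mapsto l(s)-l(g^{-1}s)$ is bounded for every $g\in\Gamma$, and $(l^2+1)^{-1}$ vanishes at infinity. Let $D_l$ be the closure of the operator on $\ell^2(\Gamma,A)\otimes\mathbb C^n$ with domain $C_c(\Gamma,A)\otimes\mathbb C^n$ given by $a\delta_s\otimes\xi\mapsto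 a\delta_s\otimes l(s)\xi$. For $z\in A\rtimes_{\mathrm{alg}}\Gamma$, acting as $z\otimes1$, set $L_l(z)=\|d_l(z)\|$, where $d_l(z)$ is the bounded adjointable operator extending $[D_l,z]$. For $A=\mathbb C$ with the trivial action this seminorm on $\mathbb C\Gamma$ is denoted by $L_{D_l}$. Theorem A. Let $\Gamma$ be an amenable, countable discrete group with a proper matrix length function $l\colon\Gamma\to M_n(\mathbb C)$, and let $|||\cdot|||$ be a norm on $C_c(\Gamma,\mathbb C)$ that is order-preserving, i.e. $|||f|||\le|||h|||$ whenever $0\le f(s)\le h(s)$ for all $s\in\Gamma$. Let $\alpha$ be an action of $\Gamma$ by $*$-automorphisms on a unital $C^*$-algebra $A$, let $\mathcal X\subseteq A$ be an operator system preserved by the action, and let $L_{\mathcal X}\colon\mathcal X\to[0,\infty)$ be a seminorm. Suppose that $(\mathcal X,L_{\mathcal X})$ and $(\mathbb C\Gamma,L_{D_l})$ are compact quantum metric spaces. Then for every $z\in\mathcal X\rtimes_{\mathrm{alg}}\Gamma$ the operator $z\otimes 1$ preserves the domain of $D_l$ and $[D_l,z]$ extends to a bounded adjointable operator (so that $L_l(z)$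 is defined), and, with $L_H(z)=|||\,g\mapsto L_{\mathcal X}(E_g(z))\,|||$, the seminorm $$L(z)=\max\{L_l(z),\,L_H(z),\,L_H(z^*)\}$$ makes $(\mathcal X\rtimes_{\mathrm{alg}}\Gamma,L)$ a compact quantum metric space. -/

import Mathlib

set_option linter.unusedSectionVars false
open scoped ComplexOrder Topology ENNReal
open Filter MulOpposite

noncomputable section

/-! ### The Hilbert module `ℓ²(I, A)` -/

section L2

variable {I A : Type*} [CStarAlgebra A] [PartialOrder A] [StarOrderedRing A]

theorem summable_of_nonneg_of_le_cstar {f g : I → A} (hf : ∀ i, 0 ≤ f i) (hfg : ∀ i, f i ≤ g i)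
    (hg : Summable g) : Summable f := by
  rw [summable_iff_vanishing_norm] at hg ⊢
  intro ε hε
  obtain ⟨s, hs⟩ := hg ε hε
  refine ⟨s, fun t ht => lt_of_le_of_lt ?_ (hs t ht)⟩
  exact CStarAlgebra.norm_le_norm_of_nonneg_of_le (Finset.sum_nonneg fun i _ => hf i)
    (Finset.sum_le_sum fun i _ => hfg i)

theorem star_add_mul_add_le (a b : A) :
    star (a + b) * (a + b) ≤ (2 : ℂ) • (star a * a) + (2 : ℂ) • (star b * b) := by
  rw [← sub_nonneg]
  have : (2 : ℂ) • (star a * a) + (2 : ℂ) • (star b * b) - star (a + b) * (a + b)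
      = star (a - b) * (a - b) := by
    simp only [two_smul, star_add, star_sub]
    noncomm_ring
  rw [this]
  exact star_mul_self_nonneg _

theorem star_mul_mul_le (x a : A) : star (x * a) * (x * a) ≤ ((‖x‖ ^ 2 : ℝ) : ℂ) • (star a * a) := by
  have h := CStarAlgebra.star_left_conjugate_le_norm_smul (a := a) (b := star x * x)
    (IsSelfAdjoint.star_mul_self x)
  rw [CStarRing.norm_star_mul_self, ← pow_two] at h
  rw [Complex.coe_smul]
  simpa [mul_assoc] using h

variable (I A) in
/-- The complex vector space of families `(aᵢ)` in `A` for which `∑ aᵢ* aᵢ` converges in norm. -/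
def l2Submodule : Submodule ℂ (I → A) where
  carrier := {f | Summable fun i => star (f i) * f i}
  zero_mem' := by simp [summable_zero]
  add_mem' {f g} hf hg := summable_of_nonneg_of_le_cstar (fun i => star_mul_self_nonneg _)
    (fun i => star_add_mul_add_le (f i) (g i)) ((hf.const_smul (2 : ℂ)).add (hg.const_smul (2 : ℂ)))
  smul_mem' c f hf := by
    have : (fun i => star ((c • f) i) * (c • f) i) = fun i => (star c * c) • (star (f i) * f i) := by
      ext i
      simp [smul_smul, mul_comm]
    simp only [Set.mem_ofPred_eq, this]
    exact hf.const_smul _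

variable (I A) in
/-- The Hilbert `C*`-module `ℓ²(I, A)`. -/
def L2 : Type _ := l2Submodule I A

namespace L2

instance : AddCommGroup (L2 I A) := inferInstanceAs (AddCommGroup (l2Submodule I A))

instance : Module ℂ (L2 I A) := inferInstanceAs (Module ℂ (l2Submodule I A))

/-- The element of `ℓ²(I, A)` given by a square-summable family. -/
def mk (f : I → A) (hf : Summable fun i => star (f i) * f i) : L2 I A := ⟨f, hf⟩

instance : CoeFun (L2 I A) fun _ => I → A := ⟨fun f => f.1⟩

@[ext] theorem ext {f g : L2 I A} (h : ∀ i, f i = g i) : f = g := Subtype.ext (funext h)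

@[simp] theorem mk_apply (f : I → A) (hf : Summable fun i => star (f i) * f i) (i : I) :
    mk f hf i = f i := rfl

@[simp] theorem zero_apply (i : I) : (0 : L2 I A) i = 0 := rfl

@[simp] theorem add_apply (f g : L2 I A) (i : I) : (f + g) i = f i + g i := rfl

@[simp] theorem sub_apply (f g : L2 I A) (i : I) : (f - g) i = f i - g i := rfl

@[simp] theorem smul_apply (c : ℂ) (f : L2 I A) (i : I) : (c • f) i = c • f i := rfl

theorem summable_self (f : L2 I A) : Summable fun i => star (f i) * f i := f.2

theorem summable_inner (f g : L2 I A) : Summable fun i => star (f i) * g i := by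
  have h : (fun i => star (f i) * g i) = fun i => (1 / 4 : ℂ) •
      ((star ((f + g) i) * (f + g) i - star ((f - g) i) * (f - g) i)
        - Complex.I • (star ((f + Complex.I • g) i) * (f + Complex.I • g) i
        - star ((f - Complex.I • g) i) * (f - Complex.I • g) i)) := by
    ext i
    simp only [add_apply, sub_apply, smul_apply, star_add, star_sub, star_smul, add_mul, mul_add,
      sub_mul, mul_sub, smul_mul_assoc, mul_smul_comm, RCLike.star_def, Complex.conj_I, smul_sub,
      smul_add, smul_smul]
    match_scalars <;> ring_nf <;> norm_num [Complex.I_sq]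
  rw [h]
  exact ((((f + g).summable_self).sub ((f - g).summable_self)).sub
    ((((f + Complex.I • g).summable_self).sub
      ((f - Complex.I • g).summable_self)).const_smul _)).const_smul _

/-- The right action of `A` on `ℓ²(I, A)`. -/
instance : SMul Aᵐᵒᵖ (L2 I A) where
  smul a f := mk (fun i => f i * a.unop) <| by
    have : (fun i => star (f i * a.unop) * (f i * a.unop))
        = fun i => star a.unop * (star (f i) * f i) * a.unop := by
      ext i; simp [mul_assoc]
    show Summable _
    rw [this]
    exact (f.summable_self.mul_left _).mul_right _

@[simp] theorem op_smul_apply (a : Aᵐᵒᵖ) (f : L2 I A) (i : I) : (a • f) i = f i * a.unop := rfl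

/-- The norm `‖f‖ = ‖∑ fᵢ* fᵢ‖^{1/2}`. -/
instance : Norm (L2 I A) where
  norm f := √‖∑' i, star (f i) * f i‖

theorem norm_def (f : L2 I A) : ‖f‖ = √‖∑' i, star (f i) * f i‖ := rfl

theorem self_le_tsum (f : L2 I A) (i : I) : star (f i) * f i ≤ ∑' j, star (f j) * f j :=
  f.summable_self.le_tsum i fun j _ => star_mul_self_nonneg (f j)

/-- `ℓ²(I, A)` as a right Hilbert `A`-module, with inner product `⟪f, g⟫ = ∑ fᵢ* gᵢ`. A right
`A`-module is a module over the opposite algebra. -/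
instance : CStarModule Aᵐᵒᵖ (L2 I A) where
  inner f g := op (∑' i, star (f i) * g i)
  inner_add_right {f g h} := by
    rw [← op_add, ← (f.summable_inner g).tsum_add (f.summable_inner h)]
    simp [mul_add]
  inner_self_nonneg {f} := by
    rw [← unop_le_unop]
    exact tsum_nonneg fun i => star_mul_self_nonneg (f i)
  inner_self {f} := by
    constructor
    · intro h
      rw [op_eq_zero_iff] at h
      ext i
      have h1 := self_le_tsum f i
      rw [h] at h1
      exact CStarRing.star_mul_self_eq_zero_iff _ |>.1 (le_antisymm h1 (star_mul_self_nonneg _))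
    · rintro rfl
      simp
  inner_op_smul_right {a f g} := by
    apply unop_injective
    simp only [op_smul_apply, unop_op, unop_mul, ← mul_assoc]
    exact (f.summable_inner g).tsum_mul_right _
  inner_smul_right_complex {c f g} := by
    rw [← op_smul, ← (f.summable_inner g).tsum_const_smul]
    simp
  star_inner f g := by
    rw [← op_star, tsum_star]
    simp
  norm_eq_sqrt_norm_inner_self f := by rw [norm_op]; rfl

theorem inner_def (f g : L2 I A) : inner Aᵐᵒᵖ f g = op (∑' i, star (f i) * g i) := rfl

instance : NormedAddCommGroup (L2 I A) := CStarModule.normedAddCommGroup Aᵐᵒᵖ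

instance : NormedSpace ℂ (L2 I A) := .ofCore (CStarModule.normedSpaceCore Aᵐᵒᵖ)

theorem norm_sq (f : L2 I A) : ‖f‖ ^ 2 = ‖∑' i, star (f i) * f i‖ := by
  rw [norm_def, Real.sq_sqrt (norm_nonneg _)]

theorem norm_sum_le (f : L2 I A) (s : Finset I) : ‖∑ i ∈ s, star (f i) * f i‖ ≤ ‖f‖ ^ 2 := by
  rw [norm_sq]
  exact CStarAlgebra.norm_le_norm_of_nonneg_of_le
    (Finset.sum_nonneg fun i _ => star_mul_self_nonneg (f i))
    (f.summable_self.sum_le_tsum s fun i _ => star_mul_self_nonneg (f i))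

theorem norm_apply_le (f : L2 I A) (i : I) : ‖f i‖ ≤ ‖f‖ := by
  have h := norm_sum_le f {i}
  rw [Finset.sum_singleton, CStarRing.norm_star_mul_self, ← pow_two] at h
  exact (pow_le_pow_iff_left₀ (norm_nonneg _) (norm_nonneg _) two_ne_zero).1 h

theorem norm_le_of_sum_le (f : L2 I A) {C : ℝ} (hC : 0 ≤ C)
    (h : ∀ s : Finset I, ‖∑ i ∈ s, star (f i) * f i‖ ≤ C ^ 2) : ‖f‖ ≤ C := by
  rw [← pow_le_pow_iff_left₀ (norm_nonneg _) hC two_ne_zero, norm_sq]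
  exact le_of_tendsto f.summable_self.hasSum.norm (Eventually.of_forall h)

instance : CompleteSpace (L2 I A) := by
  refine Metric.complete_of_cauchySeq_tendsto fun u hu => ?_
  have hpt : ∀ i, ∃ a, Tendsto (fun n => u n i) atTop (𝓝 a) := by
    intro i
    refine cauchySeq_tendsto_of_complete (Metric.cauchySeq_iff.2 fun ε hε => ?_)
    obtain ⟨N, hN⟩ := Metric.cauchySeq_iff.1 hu ε hε
    refine ⟨N, fun m hm n hn => lt_of_le_of_lt ?_ (hN m hm n hn)⟩
    rw [dist_eq_norm, dist_eq_norm, ← sub_apply]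
    exact norm_apply_le _ i
  choose f hf using hpt
  have key : ∀ ε > 0, ∃ N, ∀ n ≥ N, ∀ s : Finset I,
      ‖∑ i ∈ s, star (f i - u n i) * (f i - u n i)‖ ≤ ε ^ 2 := by
    intro ε hε
    obtain ⟨N, hN⟩ := Metric.cauchySeq_iff.1 hu ε hε
    refine ⟨N, fun n hn s => ?_⟩
    have ht : Tendsto (fun m => ‖∑ i ∈ s, star (u m i - u n i) * (u m i - u n i)‖) atTop
        (𝓝 ‖∑ i ∈ s, star (f i - u n i) * (f i - u n i)‖) := by
      refine (tendsto_finsetSum s fun i _ => ?_).norm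
      exact (((hf i).sub_const _).star).mul ((hf i).sub_const _)
    refine le_of_tendsto ht (eventually_atTop.2 ⟨N, fun m hm => ?_⟩)
    have h1 := hN m hm n hn
    rw [dist_eq_norm] at h1
    exact (norm_sum_le (u m - u n) s).trans (pow_le_pow_left₀ (norm_nonneg _) h1.le 2)
  have hmem : Summable fun i => star (f i) * f i := by
    rw [summable_iff_vanishing_norm]
    intro ε hε
    obtain ⟨N, hN⟩ := key (√(ε / 8)) (by positivity)
    obtain ⟨s, hs⟩ := (summable_iff_vanishing_norm.1 (u N).summable_self) (ε / 8) (by positivity)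
    refine ⟨s, fun t ht => ?_⟩
    have h1 := hN N le_rfl t
    rw [Real.sq_sqrt (by positivity)] at h1
    have h2 := hs t ht
    have h3 : ‖∑ i ∈ t, star (f i) * f i‖ ≤
        ‖∑ i ∈ t, ((2 : ℂ) • (star (f i - u N i) * (f i - u N i))
          + (2 : ℂ) • (star (u N i) * u N i))‖ := by
      refine CStarAlgebra.norm_le_norm_of_nonneg_of_le
        (Finset.sum_nonneg fun i _ => star_mul_self_nonneg (f i)) (Finset.sum_le_sum fun i _ => ?_)
      simpa using star_add_mul_add_le (f i - u N i) (u N i)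
    rw [Finset.sum_add_distrib, ← Finset.smul_sum, ← Finset.smul_sum] at h3
    have h4 := h3.trans (norm_add_le _ _)
    rw [norm_smul, norm_smul] at h4
    rw [Complex.norm_ofNat] at h4
    linarith
  refine ⟨mk f hmem, Metric.tendsto_atTop.2 fun ε hε => ?_⟩
  obtain ⟨N, hN⟩ := key (ε / 2) (by positivity)
  refine ⟨N, fun n hn => ?_⟩
  rw [dist_comm, dist_eq_norm]
  refine lt_of_le_of_lt (norm_le_of_sum_le _ (by positivity) (hN n hn)) (by linarith)

/-- A finitely supported family. -/
def ofFinite (f : I → A) (hf : {i | f i ≠ 0}.Finite) : L2 I A :=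
  mk f (summable_of_hasFiniteSupport (hf.subset fun i hi h0 => hi (by simp [h0])))

@[simp] theorem ofFinite_apply (f : I → A) (hf : {i | f i ≠ 0}.Finite) (i : I) :
    ofFinite f hf i = f i := rfl

open scoped Classical in
/-- The family `a δᵢ`, equal to `a` in position `i` and zero elsewhere. -/
def single (i : I) (a : A) : L2 I A :=
  ofFinite (Pi.single i a) ((Set.finite_singleton i).subset fun j hj => by
    by_contra h
    exact hj (Pi.single_eq_of_ne (M := fun _ => A) h a))

open scoped Classical in
@[simp] theorem single_apply (i j : I) (a : A) :
    single i a j = (Pi.single i a : I → A) j := rfl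

end L2

end L2

/-! ### Adjointable operators on a Hilbert module -/

section Adjointable

variable (B E : Type*) [CStarAlgebra B] [PartialOrder B] [StarOrderedRing B]
  [NormedAddCommGroup E] [NormedSpace ℂ E] [SMul B E] [CStarModule B E]

/-- The algebra of bounded operators on a Hilbert `B`-module `E` which have an adjoint. -/
def adjointableSubalgebra : Subalgebra ℂ (E →L[ℂ] E) where
  carrier := {T | ∃ S : E →L[ℂ] E, ∀ x y : E, inner B (S x) y = inner B x (T y)}
  mul_mem' := by
    rintro T T' ⟨S, hS⟩ ⟨S', hS'⟩
    exact ⟨S' * S, fun x y => by simp [hS, hS']⟩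
  add_mem' := by
    rintro T T' ⟨S, hS⟩ ⟨S', hS'⟩
    exact ⟨S + S', fun x y => by simp [hS, hS']⟩
  algebraMap_mem' c := ⟨algebraMap ℂ _ (star c), fun x y => by
    simp [Algebra.algebraMap_eq_smul_one]⟩

/-- The type of bounded adjointable operators on a Hilbert `B`-module `E`, with the operator
norm. -/
def Adjointable : Type _ := adjointableSubalgebra B E

variable {B E}

namespace Adjointable

instance : NormedRing (Adjointable B E) := inferInstanceAs (NormedRing (adjointableSubalgebra B E))

instance : NormedAlgebra ℂ (Adjointable B E) :=
  inferInstanceAs (NormedAlgebra ℂ (adjointableSubalgebra B E))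

/-- An adjointable operator as a bounded operator. -/
def toCLM (T : Adjointable B E) : E →L[ℂ] E := T.1

/-- An operator with a given adjoint. -/
def mk (T S : E →L[ℂ] E) (h : ∀ x y : E, inner B (S x) y = inner B x (T y)) : Adjointable B E := ⟨T, S, h⟩

instance : FunLike (Adjointable B E) E E where
  coe T := T.toCLM
  coe_injective _ _ h := Subtype.ext (ContinuousLinearMap.ext fun x => congrFun h x)

@[ext] theorem ext {S T : Adjointable B E} (h : ∀ x, S x = T x) : S = T := DFunLike.ext _ _ h

@[simp] theorem toCLM_apply (T : Adjointable B E) (x : E) : T.toCLM x = T x := rfl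

@[simp] theorem mk_apply (T S : E →L[ℂ] E) (h : ∀ x y : E, inner B (S x) y = inner B x (T y)) (x : E) :
    mk T S h x = T x := rfl

@[simp] theorem add_apply (S T : Adjointable B E) (x : E) : (S + T) x = S x + T x := rfl

@[simp] theorem mul_apply (S T : Adjointable B E) (x : E) : (S * T) x = S (T x) := rfl

@[simp] theorem smul_apply (c : ℂ) (T : Adjointable B E) (x : E) : (c • T) x = c • T x := rfl

@[simp] theorem one_apply (x : E) : (1 : Adjointable B E) x = x := rfl

theorem ext_inner {x y : E} (h : ∀ z : E, inner B z x = inner B z y) : x = y := by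
  rw [← sub_eq_zero, ← CStarModule.inner_self (A := B)]
  rw [CStarModule.inner_sub_right, h, sub_self]

/-- The adjoint of an adjointable operator. -/
instance : Star (Adjointable B E) where
  star T := mk T.2.choose T.1 fun x y => by
    rw [← CStarModule.star_inner, ← T.2.choose_spec, CStarModule.star_inner]

theorem inner_star_left (T : Adjointable B E) (x y : E) : inner B (star T x) y = inner B x (T y) :=
  T.2.choose_spec x y

theorem inner_star_right (T : Adjointable B E) (x y : E) : inner B x (star T y) = inner B (T x) y := by
  rw [← CStarModule.star_inner, inner_star_left, CStarModule.star_inner]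

theorem eq_star_of_inner {S T : Adjointable B E} (h : ∀ x y : E, inner B x (S y) = inner B (T x) y) :
    S = star T :=
  ext fun y => ext_inner (B := B) fun z => by rw [h, inner_star_right]

instance : StarRing (Adjointable B E) where
  star_involutive T := (eq_star_of_inner fun x y => (inner_star_left T x y).symm).symm
  star_mul S T := (eq_star_of_inner fun x y => by simp [inner_star_right]).symm
  star_add S T := (eq_star_of_inner fun x y => by simp [inner_star_right]).symm

instance : StarModule ℂ (Adjointable B E) where
  star_smul c T := (eq_star_of_inner fun x y => by simp [inner_star_right]).symm

theorem norm_apply_le (T : Adjointable B E) (x : E) : ‖T x‖ ≤ ‖T‖ * ‖x‖ := T.1.le_opNorm x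

instance : CStarRing (Adjointable B E) where
  norm_mul_self_le T := by
    have h : ‖T‖ ≤ √‖star T * T‖ := by
      refine ContinuousLinearMap.opNorm_le_bound _ (Real.sqrt_nonneg _) fun x => ?_
      change ‖T x‖ ≤ _
      rw [← pow_le_pow_iff_left₀ (norm_nonneg _) (by positivity) two_ne_zero, mul_pow,
        Real.sq_sqrt (norm_nonneg (star T * T)), CStarModule.norm_sq_eq B, ← inner_star_right,
        ← mul_apply]
      refine (CStarModule.norm_inner_le E).trans ?_
      calc ‖x‖ * ‖(star T * T) x‖ ≤ ‖x‖ * (‖star T * T‖ * ‖x‖) := by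
            gcongr; exact norm_apply_le _ _
        _ = ‖star T * T‖ * ‖x‖ ^ 2 := by ring
    calc ‖T‖ * ‖T‖ ≤ √‖star T * T‖ * √‖star T * T‖ := by gcongr
      _ = ‖star T * T‖ := Real.mul_self_sqrt (norm_nonneg _)

variable [CompleteSpace E]

instance : CompleteSpace (Adjointable B E) := by
  refine Metric.complete_of_cauchySeq_tendsto fun u hu => ?_
  have h1 : CauchySeq fun n => (u n).toCLM :=
    uniformContinuous_subtype_val.comp_cauchySeq hu
  have h2 : CauchySeq fun n => (star (u n)).toCLM := by
    refine Metric.cauchySeq_iff.2 fun ε hε => ?_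
    obtain ⟨N, hN⟩ := Metric.cauchySeq_iff.1 hu ε hε
    refine ⟨N, fun m hm n hn => ?_⟩
    have h3 : ‖star (u m - u n)‖ < ε := by
      rw [norm_star (u m - u n)]
      exact (dist_eq_norm (u m) (u n)).symm.trans_lt (hN m hm n hn)
    rw [star_sub] at h3
    rw [dist_eq_norm]
    exact h3
  obtain ⟨T, hT⟩ := cauchySeq_tendsto_of_complete h1
  obtain ⟨S, hS⟩ := cauchySeq_tendsto_of_complete h2
  have hTS : ∀ x y : E, inner B (S x) y = inner B x (T y) := by
    intro x y
    have a1 : Tendsto (fun n => inner B (star (u n) x) y) atTop (𝓝 (inner B (S x) y)) :=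
      (CStarModule.continuous_inner (A := B)).tendsto (S x, y) |>.comp
        (((ContinuousLinearMap.apply ℂ E x).continuous.tendsto S |>.comp hS).prodMk_nhds
          tendsto_const_nhds)
    have a2 : Tendsto (fun n => inner B x (u n y)) atTop (𝓝 (inner B x (T y))) :=
      (CStarModule.continuous_inner (A := B)).tendsto (x, T y) |>.comp
        ((tendsto_const_nhds (x := x)).prodMk_nhds
          ((ContinuousLinearMap.apply ℂ E y).continuous.tendsto T |>.comp hT))
    simp only [inner_star_left] at a1
    exact tendsto_nhds_unique a1 a2
  exact ⟨mk T S hTS, tendsto_subtype_rng.2 hT⟩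

/-- The bounded adjointable operators on a Hilbert module form a unital `C*`-algebra. -/
instance : CStarAlgebra (Adjointable B E) where

end Adjointable

end Adjointable

/-! ### Operator systems and compact quantum metric spaces -/

section OperatorSystem

variable {B : Type*} [CStarAlgebra B]

variable (B) in
/-- An operator system in a unital `C*`-algebra: a unital `*`-invariant subspace. -/
structure OperatorSystem extends Submodule ℂ B where
  one_mem' : (1 : B) ∈ carrier
  star_mem' : ∀ {x : B}, x ∈ carrier → star x ∈ carrier

namespace OperatorSystem

instance : CoeSort (OperatorSystem B) (Type _) := ⟨fun X => X.toSubmodule⟩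

instance : Membership B (OperatorSystem B) := ⟨fun X x => x ∈ X.toSubmodule⟩

instance (X : OperatorSystem B) : One X := ⟨⟨1, X.one_mem'⟩⟩

instance (X : OperatorSystem B) : Star X := ⟨fun x => ⟨star x.1, X.star_mem' x.2⟩⟩

variable (B) in
/-- The whole `C*`-algebra as an operator system. -/
def univ : OperatorSystem B where
  toSubmodule := ⊤
  one_mem' := Submodule.mem_top
  star_mem' _ := Submodule.mem_top

end OperatorSystem

/-- A state on an operator system: a unital linear functional which is positive, meaning that it
is nonnegative on the elements of `X` that are positive (of the form `b* b`) in the ambient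
`C*`-algebra. -/
structure OperatorSystem.State (X : OperatorSystem B) extends X →ₗ[ℂ] ℂ where
  map_one' : toFun 1 = 1
  nonneg' : ∀ (b : B) (hb : star b * b ∈ X.toSubmodule), 0 ≤ toFun ⟨star b * b, hb⟩

variable {X : OperatorSystem B}

instance : CoeFun X.State fun _ => X → ℂ := ⟨fun φ => φ.toLinearMap⟩

variable (X) in
/-- The weak-`*` topology on the state space: the topology of pointwise convergence on `X`. -/
@[reducible]
def weakStarTopology : TopologicalSpace X.State :=
  TopologicalSpace.induced (fun φ => (φ : X → ℂ)) inferInstance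

/-- A slip-norm on an operator system: a seminorm with values in `[0, ∞)` which vanishes on the
scalars and is `*`-invariant. -/
structure IsSlipNorm (L : X → ℝ) : Prop where
  nonneg : ∀ x, 0 ≤ L x
  add_le : ∀ x y, L (x + y) ≤ L x + L y
  smul : ∀ (c : ℂ) (x : X), L (c • x) = ‖c‖ * L x
  scalar : ∀ c : ℂ, L (c • (1 : X)) = 0
  star : ∀ x : X, L (star x) = L x

/-- The Monge-Kantorovich distance `ρ_L(φ, ψ) = sup {|φ(x) - ψ(x)| : L(x) ≤ 1} ∈ [0, ∞]`. -/
def mongeKantorovichDist (L : X → ℝ) (φ ψ : X.State) : ℝ≥0∞ :=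
  ⨆ (x : X) (_ : L x ≤ 1), ENNReal.ofReal ‖φ x - ψ x‖

/-- The Monge-Kantorovich extended (pseudo)metric on the state space, together with the topology
given by its open balls. -/
@[reducible]
def mongeKantorovich (L : X → ℝ) : PseudoEMetricSpace X.State where
  edist := mongeKantorovichDist L
  edist_self φ := by simp [mongeKantorovichDist]
  edist_comm φ ψ := by simp only [mongeKantorovichDist, norm_sub_rev]
  edist_triangle φ ψ χ := by
    refine iSup₂_le fun x hx => ?_
    calc ENNReal.ofReal ‖φ x - χ x‖
        ≤ ENNReal.ofReal (‖φ x - ψ x‖ + ‖ψ x - χ x‖) :=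
          ENNReal.ofReal_le_ofReal (norm_sub_le_norm_sub_add_norm_sub _ _ _)
      _ = ENNReal.ofReal ‖φ x - ψ x‖ + ENNReal.ofReal ‖ψ x - χ x‖ :=
          ENNReal.ofReal_add (norm_nonneg _) (norm_nonneg _)
      _ ≤ _ := add_le_add (le_iSup₂_of_le x hx le_rfl) (le_iSup₂_of_le x hx le_rfl)

/-- `(X, L)` is a compact quantum metric space: `L` is a slip-norm on the operator system `X` and
the Monge-Kantorovich metric metrizes the weak-`*` topology on the state space of `X`. -/
structure IsCompactQuantumMetricSpace (X : OperatorSystem B) (L : X → ℝ) : Prop where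
  isSlipNorm : IsSlipNorm L
  metrizes : (mongeKantorovich L).toUniformSpace.toTopologicalSpace = weakStarTopology X

end OperatorSystem

/-! ### Reduced crossed products -/

section CrossedProduct

variable {Γ A : Type*} [Group Γ] [CStarAlgebra A] [PartialOrder A] [StarOrderedRing A]
  (α : Γ →* (A ≃⋆ₐ[ℂ] A))

/-- The underlying linear map of `π_α(x) λ_g`. -/
def crossedLin (x : A) (g : Γ) : L2 Γ A →ₗ[ℂ] L2 Γ A where
  toFun f := L2.mk (fun t => α t⁻¹ x * f (g⁻¹ * t)) <| by
    refine summable_of_nonneg_of_le_cstar (fun i => star_mul_self_nonneg _)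
      (fun i => (star_mul_mul_le _ _).trans_eq ?_)
      ((((Equiv.mulLeft g⁻¹).summable_iff).2 f.summable_self).const_smul ((‖x‖ ^ 2 : ℝ) : ℂ))
    rw [StarAlgEquiv.norm_map]
    rfl
  map_add' f h := by ext t; simp [mul_add]
  map_smul' c f := by ext t; simp

@[simp] theorem crossedLin_apply (x : A) (g : Γ) (f : L2 Γ A) (t : Γ) :
    crossedLin α x g f t = α t⁻¹ x * f (g⁻¹ * t) := rfl

theorem norm_crossedLin_le (x : A) (g : Γ) (f : L2 Γ A) : ‖crossedLin α x g f‖ ≤ ‖x‖ * ‖f‖ := by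
  refine L2.norm_le_of_sum_le _ (by positivity) fun s => ?_
  have h : ∑ t ∈ s, star (crossedLin α x g f t) * crossedLin α x g f t
      ≤ ((‖x‖ ^ 2 : ℝ) : ℂ) • ∑ t ∈ s.map (Equiv.mulLeft g⁻¹).toEmbedding, star (f t) * f t := by
    rw [Finset.sum_map, Finset.smul_sum]
    refine Finset.sum_le_sum fun t _ => (star_mul_mul_le _ _).trans_eq ?_
    rw [StarAlgEquiv.norm_map]
    rfl
  refine (CStarAlgebra.norm_le_norm_of_nonneg_of_le
    (Finset.sum_nonneg fun i _ => star_mul_self_nonneg _) h).trans ?_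
  rw [norm_smul, mul_pow, Complex.norm_real, Real.norm_of_nonneg (by positivity)]
  gcongr
  exact L2.norm_sum_le f _

/-- The operator `π_α(x) λ_g` on `ℓ²(Γ, A)`, sending `a δ_s` to `α_{gs}⁻¹(x) a δ_{gs}`; in
coordinates, `(π_α(x) λ_g f)(t) = α_t⁻¹(x) f(g⁻¹ t)`. -/
def crossedGen (x : A) (g : Γ) : Adjointable Aᵐᵒᵖ (L2 Γ A) :=
  Adjointable.mk ((crossedLin α x g).mkContinuous ‖x‖ (norm_crossedLin_le α x g))
    ((crossedLin α (α g⁻¹ (star x)) g⁻¹).mkContinuous _ (norm_crossedLin_le α _ g⁻¹)) fun f h => by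
      simp only [L2.inner_def, LinearMap.mkContinuous_apply, crossedLin_apply, inv_inv, star_mul]
      congr 1
      rw [← (Equiv.mulLeft g⁻¹).tsum_eq]
      refine tsum_congr fun t => ?_
      have : α (g⁻¹ * t)⁻¹ (α g⁻¹ (star x)) = star (α t⁻¹ x) := by
        rw [← StarAlgEquiv.mul_apply, ← map_mul, ← map_star]
        simp
      simp only [Equiv.coe_mulLeft, mul_inv_cancel_left, this, mul_assoc, star_star]

@[simp] theorem crossedGen_apply (x : A) (g : Γ) (f : L2 Γ A) (t : Γ) :
    crossedGen α x g f t = α t⁻¹ x * f (g⁻¹ * t) := rfl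

theorem star_crossedGen (x : A) (g : Γ) :
    star (crossedGen α x g) = crossedGen α (α g⁻¹ (star x)) g⁻¹ := by
  refine (Adjointable.eq_star_of_inner fun f h => ?_).symm
  simp only [L2.inner_def, crossedGen_apply, inv_inv, star_mul]
  congr 1
  rw [← (Equiv.mulLeft g⁻¹).tsum_eq]
  refine tsum_congr fun t => ?_
  have : α (g⁻¹ * t)⁻¹ (α g⁻¹ (star x)) = star (α t⁻¹ x) := by
    rw [← StarAlgEquiv.mul_apply, ← map_mul, ← map_star]
    simp
  simp only [Equiv.coe_mulLeft, mul_inv_cancel_left, this, mul_assoc]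

theorem crossedGen_one_one : crossedGen α 1 1 = 1 := by
  ext f t
  simp

/-- The reduced crossed product `A ⋊ Γ`: the `C*`-algebra of adjointable operators on `ℓ²(Γ, A)`
generated by the operators `π_α(x) λ_g`. -/
def reducedCrossedProductSubalgebra : StarSubalgebra ℂ (Adjointable Aᵐᵒᵖ (L2 Γ A)) :=
  (StarAlgebra.adjoin ℂ (Set.range fun p : A × Γ => crossedGen α p.1 p.2)).topologicalClosure

instance : IsClosed (reducedCrossedProductSubalgebra α : Set (Adjointable Aᵐᵒᵖ (L2 Γ A))) :=
  StarSubalgebra.isClosed_topologicalClosure _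

/-- The reduced crossed product `A ⋊ Γ` as a type. -/
def ReducedCrossedProduct : Type _ := reducedCrossedProductSubalgebra α

instance : CStarAlgebra (ReducedCrossedProduct α) :=
  inferInstanceAs (CStarAlgebra (reducedCrossedProductSubalgebra α))

variable {α} in
/-- An element of the reduced crossed product as an operator on `ℓ²(Γ, A)`. -/
def ReducedCrossedProduct.toOp (z : ReducedCrossedProduct α) : Adjointable Aᵐᵒᵖ (L2 Γ A) := z.1

/-- The generator `π_α(x) λ_g` as an element of the reduced crossed product. -/
def gen (x : A) (g : Γ) : ReducedCrossedProduct α :=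
  ⟨crossedGen α x g, StarSubalgebra.le_topologicalClosure _
    (StarAlgebra.subset_adjoin ℂ _ ⟨(x, g), rfl⟩)⟩

/-- The algebraic crossed product `X ⋊_alg Γ` of an invariant operator system `X ⊆ A`: the span of
the elements `π_α(x) λ_g` with `x ∈ X` and `g ∈ Γ`, inside the reduced crossed product. -/
def algCrossedProduct (X : OperatorSystem A) (hX : ∀ g, ∀ x ∈ X, α g x ∈ X) :
    OperatorSystem (ReducedCrossedProduct α) where
  toSubmodule := Submodule.span ℂ {z | ∃ x ∈ X, ∃ g : Γ, z = gen α x g}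
  one_mem' := Submodule.subset_span ⟨1, X.one_mem', 1, Subtype.ext (crossedGen_one_one α).symm⟩
  star_mem' {z} hz := by
    refine Submodule.span_induction (p := fun z _ => star z ∈ Submodule.span ℂ
      {z | ∃ x ∈ X, ∃ g : Γ, z = gen α x g}) ?_ ?_ ?_ ?_ hz
    · rintro _ ⟨x, hx, g, rfl⟩
      exact Submodule.subset_span ⟨α g⁻¹ (star x), hX _ _ (X.star_mem' hx), g⁻¹,
        Subtype.ext (star_crossedGen α x g)⟩
    · rw [star_zero]
      exact Submodule.zero_mem _
    · intro x y _ _ hx hy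
      rw [star_add]
      exact Submodule.add_mem _ hx hy
    · intro c x _ hx
      rw [star_smul]
      exact Submodule.smul_mem _ _ hx

/-- The conditional expectation `E : A ⋊ Γ → A`, `E(z) = ⟪δ_e, z δ_e⟫ = (z δ_e)(e)`. -/
def condExp (z : ReducedCrossedProduct α) : A := z.toOp (L2.single 1 1) 1

/-- The map `E_g : A ⋊ Γ → A`, `E_g(z) = E(z λ_g⁻¹)`. -/
def coeff (g : Γ) (z : ReducedCrossedProduct α) : A := condExp α (z * gen α 1 g⁻¹)

open scoped Classical in
/-- `E_g` reads off the coefficients of the elements of the algebraic crossed product. -/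
theorem coeff_gen (g s : Γ) (x : A) : coeff α g (gen α x s) = if g = s then x else 0 := by
  change crossedGen α x s (crossedGen α 1 g⁻¹ (L2.single 1 1)) 1 = _
  simp [Pi.single_apply, mul_inv_eq_one]

theorem coeff_add (g : Γ) (z w : ReducedCrossedProduct α) :
    coeff α g (z + w) = coeff α g z + coeff α g w := by
  rw [coeff, add_mul]; rfl

theorem coeff_smul (g : Γ) (c : ℂ) (z : ReducedCrossedProduct α) :
    coeff α g (c • z) = c • coeff α g z := by
  rw [coeff, smul_mul_assoc]; rfl

theorem coeff_zero (g : Γ) : coeff α g 0 = 0 := by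
  rw [coeff, zero_mul]; rfl

variable {X : OperatorSystem A} {hX : ∀ g, ∀ x ∈ X, α g x ∈ X}

theorem coeff_mem (g : Γ) (z : algCrossedProduct α X hX) : coeff α g z.1 ∈ X := by
  refine Submodule.span_induction (p := fun z _ => coeff α g z ∈ X.toSubmodule) ?_ ?_ ?_ ?_ z.2
  · rintro _ ⟨x, hx, s, rfl⟩
    classical
    rw [coeff_gen]
    split_ifs
    exacts [hx, X.zero_mem]
  · rw [coeff_zero]
    exact X.zero_mem
  · intro x y _ _ hx hy
    rw [coeff_add]
    exact X.add_mem hx hy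
  · intro c x _ hx
    rw [coeff_smul]
    exact X.smul_mem _ hx

theorem finite_coeff (z : algCrossedProduct α X hX) : {g | coeff α g z.1 ≠ 0}.Finite := by
  refine Submodule.span_induction (p := fun z _ => {g | coeff α g z ≠ 0}.Finite) ?_ ?_ ?_ ?_ z.2
  · rintro _ ⟨x, hx, s, rfl⟩
    classical
    refine (Set.finite_singleton s).subset fun g hg => ?_
    by_contra h
    exact hg ((coeff_gen α g s x).trans (if_neg h))
  · simp [coeff_zero]
  · intro x y _ _ hx hy
    refine (hx.union hy).subset fun g hg => ?_
    by_contra h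
    simp only [Set.mem_union, Set.mem_ofPred_eq, not_or, not_not] at h
    exact hg (by rw [coeff_add, h.1, h.2, add_zero])
  · intro c x _ hx
    refine hx.subset fun g hg h => hg ?_
    rw [coeff_smul, h, smul_zero]

variable (Γ) in
/-- An order-preserving norm on the space `C_c(Γ, ℂ)` of finitely supported functions:
`‖f‖ ≤ ‖g‖` whenever `0 ≤ f(s) ≤ g(s)` for all `s`. -/
structure OrderPreservingNorm extends Seminorm ℂ (Γ →₀ ℂ) where
  eq_zero_of_map_eq_zero : ∀ f, toFun f = 0 → f = 0
  mono : ∀ f g : Γ →₀ ℂ, (∀ s, 0 ≤ f s ∧ f s ≤ g s) → toFun f ≤ toFun g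

/-- The finitely supported function `g ↦ L_X(E_g(z))`, for a seminorm `L_X` on `X` and `z` in the
algebraic crossed product. -/
def coeffSeminorm (LX : X → ℝ) (z : algCrossedProduct α X hX) : Γ →₀ ℂ :=
  ∑ g ∈ (finite_coeff α z).toFinset, Finsupp.single g (LX ⟨coeff α g z.1, coeff_mem α g z⟩ : ℂ)

/-- The seminorm `L_H(z)`, the chosen norm of `g ↦ L_X(E_g(z))`. -/
def horizontalSeminorm (N : OrderPreservingNorm Γ) (LX : X → ℝ) (z : algCrossedProduct α X hX) :
    ℝ :=
  N.toSeminorm (coeffSeminorm α LX z)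

end CrossedProduct

/-! ### Matrix length functions and the associated Dirac operators -/

section Dirac

variable {Γ A : Type*} [Group Γ] [CStarAlgebra A] [PartialOrder A] [StarOrderedRing A] {n : ℕ}

/-- Matrix length functions. -/
structure IsMatrixLength (l : Γ → Matrix (Fin n) (Fin n) ℂ) : Prop where
  isSelfAdjoint : ∀ g, (l g).IsHermitian
  eq_zero_iff : ∀ g, l g = 0 ↔ g = 1
  bounded : ∀ g, ∃ C : ℝ, ∀ s i j, ‖(l s - l (g⁻¹ * s)) i j‖ ≤ C

/-- Properness of a matrix length function: `(l² + 1)⁻¹` vanishes at infinity. -/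
def IsProperMatrixLength (l : Γ → Matrix (Fin n) (Fin n) ℂ) : Prop :=
  Tendsto (fun s => (l s ^ 2 + 1)⁻¹) cofinite (𝓝 0)

open scoped WithCStarModule

variable (Γ A n) in
/-- The Hilbert module `ℓ²(Γ, A) ⊗ ℂⁿ`, realised as the `n`-fold direct sum of `ℓ²(Γ, A)`, with
inner product `⟪ζ, ξ⟫ = ∑ᵢ ⟪ζᵢ, ξᵢ⟫`. -/
abbrev L2n : Type _ := C⋆ᵐᵒᵈ(Aᵐᵒᵖ, Fin n → L2 Γ A)

/-- The operator `T ⊗ 1` on `ℓ²(Γ, A) ⊗ ℂⁿ`. -/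
def amplify (T : Adjointable Aᵐᵒᵖ (L2 Γ A)) (ζ : L2n Γ A n) : L2n Γ A n :=
  (WithCStarModule.equiv Aᵐᵒᵖ (Fin n → L2 Γ A)).symm fun i => T (ζ i)

variable (A) in
/-- The operator `𝒟_l` with domain `C_c(Γ, A) ⊗ ℂⁿ`, sending `a δ_s ⊗ ξ` to `a δ_s ⊗ l(s) ξ`. -/
def diracCore (l : Γ → Matrix (Fin n) (Fin n) ℂ) : L2n Γ A n →ₗ.[ℂ] L2n Γ A n where
  domain :=
    { carrier := {ζ | ∀ i, {s | ζ i s ≠ 0}.Finite}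
      zero_mem' := fun i => by simp
      add_mem' := fun {ζ ξ} hζ hξ i => ((hζ i).union (hξ i)).subset fun s hs => by
        by_contra h
        simp only [Set.mem_union, Set.mem_ofPred_eq, not_or, not_not] at h
        exact hs (by simp [h.1, h.2])
      smul_mem' := fun c ζ hζ i => (hζ i).subset fun s hs h => hs (by simp [h]) }
  toFun :=
    { toFun := fun ζ => (WithCStarModule.equiv Aᵐᵒᵖ (Fin n → L2 Γ A)).symm fun i =>
        L2.ofFinite (fun s => ∑ j, l s i j • ζ.1 j s)
          ((Set.finite_iUnion fun j => ζ.2 j).subset fun s hs => by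
            by_contra h
            simp only [Set.mem_iUnion, Set.mem_ofPred_eq, not_exists, not_not] at h
            exact hs (Finset.sum_eq_zero fun j _ => by rw [h j, smul_zero]))
      map_add' := fun ζ ξ => by
        ext i s
        simp [Finset.sum_add_distrib]
      map_smul' := fun c ζ => by
        ext i s
        simp [Finset.smul_sum, smul_comm c] }

variable (A) in
/-- The Dirac operator `D_l` on `ℓ²(Γ, A) ⊗ ℂⁿ`: the closure of `𝒟_l`. -/
def dirac (l : Γ → Matrix (Fin n) (Fin n) ℂ) : L2n Γ A n →ₗ.[ℂ] L2n Γ A n := (diracCore A l).closure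

/-- `d` is a bounded adjointable operator extending the commutator `[D_l, z]`, where `z` acts as
`z ⊗ 1`. This includes that `z ⊗ 1` preserves the domain of `D_l`. -/
def IsDiracCommutator (l : Γ → Matrix (Fin n) (Fin n) ℂ) (z : Adjointable Aᵐᵒᵖ (L2 Γ A))
    (d : Adjointable Aᵐᵒᵖ (L2n Γ A n)) : Prop :=
  ∀ ζ : (dirac A l).domain, ∃ h : amplify z ζ.1 ∈ (dirac A l).domain,
    d ζ.1 = dirac A l ⟨amplify z ζ.1, h⟩ - amplify z (dirac A l ζ)

open scoped Classical in
/-- The seminorm `L_l(z) = ‖d_l(z)‖`, where `d_l(z)` is the bounded adjointable operator which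
extends `[D_l, z]` (it is unique, as the domain of `D_l` is dense). -/
def diracSeminorm (l : Γ → Matrix (Fin n) (Fin n) ℂ) (z : Adjointable Aᵐᵒᵖ (L2 Γ A)) : ℝ :=
  if h : ∃ d, IsDiracCommutator l z d then ‖h.choose‖ else 0

end Dirac

/-! ### The group algebra and amenability -/

section Group

variable (Γ : Type*) [Group Γ]

/-- The trivial action of `Γ` on `ℂ`; its reduced crossed product is the reduced group
`C*`-algebra. -/
abbrev trivialAction : Γ →* (ℂ ≃⋆ₐ[ℂ] ℂ) := 1

/-- The group algebra `ℂΓ`, the span of the unitaries `λ_g` in the reduced group `C*`-algebra. -/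
def groupAlgebra : OperatorSystem (ReducedCrossedProduct (trivialAction Γ)) :=
  algCrossedProduct (trivialAction Γ) (OperatorSystem.univ ℂ) fun _ _ _ => Submodule.mem_top

/-- The space `ℓ^∞(Γ)` of bounded real functions. -/
def boundedFunctions : Submodule ℝ (Γ → ℝ) where
  carrier := {f | ∃ C : ℝ, ∀ s, |f s| ≤ C}
  zero_mem' := ⟨0, by simp⟩
  add_mem' := by
    rintro f g ⟨C, hC⟩ ⟨D, hD⟩
    exact ⟨C + D, fun s => (abs_add_le _ _).trans (add_le_add (hC s) (hD s))⟩
  smul_mem' := by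
    rintro c f ⟨C, hC⟩
    exact ⟨|c| * C, fun s => by
      simpa [abs_mul] using mul_le_mul_of_nonneg_left (hC s) (abs_nonneg c)⟩

/-- A discrete group is amenable if `ℓ^∞(Γ)` carries a left-invariant mean. -/
def IsAmenable : Prop :=
  ∃ m : boundedFunctions Γ →ₗ[ℝ] ℝ,
    (∀ f, (∀ s, 0 ≤ f.1 s) → 0 ≤ m f) ∧
    (∀ f, (∀ s, f.1 s = 1) → m f = 1) ∧
    ∀ (g : Γ) (f f' : boundedFunctions Γ), (∀ s, f'.1 s = f.1 (g⁻¹ * s)) → m f' = m f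

end Group

end

set_option linter.unusedSectionVars false

/-!
# Compact quantum metrics on crossed products by amenable groups

A slip-norm `L` on an operator system defines a compact quantum metric space if and only if
`{x : L x ≤ 1}` is totally bounded in norm modulo scalars: one direction is the Arzelà–Ascoli
argument on the weak-`*` compact state space (`OperatorSystem.exists_finite_net`), where
`OperatorSystem.norm_le_of_forall_state` says that states control the norm, and the other direction
is `OperatorSystem.isCompactQuantumMetricSpace_of_finite_net`. So the task is to find finite nets
for the set of all `z = ∑ x_g λ_g` with `L z ≤ 1`.

*Reduction to finitely many coefficients.* Since `Γ` is amenable, Reiter's condition provides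
finitely supported unit vectors `ξ` in `ℓ²(Γ)` for which `φ(g) = ⟪ξ, λ_g ξ⟫` is finitely supported
and close to `1`. The states `λ_g ↦ φ(g)` of the group algebra converge weak-`*` to the trivial
state `λ_g ↦ 1`, hence also in the Monge–Kantorovich metric of the group algebra
(`IsAmenable.exists_finsupp_near_trivial`). The multiplier `z ↦ ∑ φ(g) x_g λ_g` differs from the
identity by at most the distance of the two states times `‖[D_l, z]‖` (`norm_sub_multiplier_le`):
for a functional `η` of norm one, the element `f = ∑ η(x_g λ_g) λ_g` of the group algebra satisfies
`‖[D_l, f]‖ ≤ ‖[D_l, z]‖` (`norm_sum_commOp_slice_le`), and `η(z)` and `η(∑ φ(g) x_g λ_g)` are the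
values of the two states at `f`. The inequality of commutators is a form of Fell's absorption
principle: the operators `λ_g` appearing in `[D_l, λ_g]` and those appearing in `x_g λ_g` act on
different tensor factors, and restricted to each diagonal the tensor product is a copy of `[D_l, z]`
twisted by an automorphism `α_p` (`sliceOp_apply`).

*Each coefficient.* The bound on the horizontal seminorm bounds `L_X(x_g)`, so each `x_g` lies in a
totally bounded set modulo scalars. For `g ≠ 1` the scalars are under control as well, because
`‖l(g)ᵢⱼ‖ ‖x_g‖ ≤ ‖[D_l, z]‖` and `l(g) ≠ 0` (`norm_coeff_mul_le`).
-/

open scoped ComplexOrder Topology ENNReal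
open Filter MulOpposite

noncomputable section

/-! ### States on operator systems -/

section States

variable {B : Type*} [CStarAlgebra B] {X : OperatorSystem B}

attribute [local instance] CStarAlgebra.spectralOrder CStarAlgebra.spectralOrderedRing

namespace OperatorSystem

@[simp] theorem coe_one : ((1 : X) : B) = 1 := rfl

@[simp] theorem coe_star (x : X) : ((star x : X) : B) = star (x : B) := rfl

/-- The selfadjoint part `(x + x*) / 2` of an element of an operator system. -/
def rePart (x : X) : X := (1 / 2 : ℂ) • (x + star x)

theorem isSelfAdjoint_rePart (x : X) : IsSelfAdjoint (rePart x : B) := by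
  simp [IsSelfAdjoint, rePart, add_comm]

theorem norm_rePart_le (x : X) : ‖(rePart x : B)‖ ≤ ‖(x : B)‖ := by
  have h := norm_add_le (x : B) (star (x : B))
  rw [norm_star] at h
  simp only [rePart, Submodule.coe_smul, Submodule.coe_add, coe_star, norm_smul]
  norm_num
  linarith

theorem rePart_add_I_smul_rePart (x : X) :
    x = rePart x + Complex.I • rePart (-(Complex.I • x)) := by
  apply Subtype.ext
  simp only [rePart, Submodule.coe_smul, Submodule.coe_add, coe_star, Submodule.coe_neg, star_neg,
    star_smul, RCLike.star_def, Complex.conj_I, smul_add, smul_neg, neg_smul, neg_neg, smul_smul]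
  match_scalars
  · linear_combination (1 / 2 : ℂ) * Complex.I_mul_I
  · linear_combination (-1 / 2 : ℂ) * Complex.I_mul_I

namespace State

variable (φ : X.State)

theorem map_add (x y : X) : φ (x + y) = φ x + φ y := φ.toLinearMap.map_add x y

theorem map_sub (x y : X) : φ (x - y) = φ x - φ y := φ.toLinearMap.map_sub x y

theorem map_smul (c : ℂ) (x : X) : φ (c • x) = c * φ x := φ.toLinearMap.map_smul c x

theorem map_one : φ 1 = 1 := φ.map_one'

theorem map_sum {ι : Type*} (s : Finset ι) (x : ι → X) : φ (∑ i ∈ s, x i) = ∑ i ∈ s, φ (x i) :=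
  _root_.map_sum φ.toLinearMap x s

theorem nonneg {x : X} (hx : 0 ≤ (x : B)) : 0 ≤ φ x := by
  obtain ⟨b, hb⟩ := CStarAlgebra.nonneg_iff_eq_star_mul_self.1 hx
  have h : star b * b ∈ X.toSubmodule := hb ▸ x.2
  obtain rfl : x = ⟨star b * b, h⟩ := Subtype.ext hb
  exact φ.nonneg' b h

theorem abs_re_le_of_isSelfAdjoint {x : X} (hx : IsSelfAdjoint (x : B)) :
    |(φ x).re| ≤ ‖(x : B)‖ ∧ (φ x).im = 0 := by
  have h1 : 0 ≤ φ (((‖(x : B)‖ : ℝ) : ℂ) • (1 : X) - x) := φ.nonneg <| by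
    have := hx.le_algebraMap_norm_self
    rw [Algebra.algebraMap_eq_smul_one] at this
    simpa [sub_nonneg] using this
  have h2 : 0 ≤ φ (((‖(x : B)‖ : ℝ) : ℂ) • (1 : X) + x) := φ.nonneg <| by
    have := hx.neg_algebraMap_norm_le_self
    rw [Algebra.algebraMap_eq_smul_one, neg_le_iff_add_nonneg'] at this
    simpa using this
  rw [map_sub, map_smul, map_one, mul_one, Complex.nonneg_iff] at h1
  rw [map_add, map_smul, map_one, mul_one, Complex.nonneg_iff] at h2
  simp only [Complex.sub_re, Complex.add_re, Complex.ofReal_re, Complex.sub_im, Complex.add_im,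
    Complex.ofReal_im] at h1 h2
  exact ⟨abs_le.2 ⟨by linarith, by linarith⟩, by linarith [h2.2]⟩

theorem norm_apply_le_of_isSelfAdjoint {x : X} (hx : IsSelfAdjoint (x : B)) :
    ‖φ x‖ ≤ ‖(x : B)‖ := by
  obtain ⟨h1, h2⟩ := φ.abs_re_le_of_isSelfAdjoint hx
  rwa [← Complex.abs_re_eq_norm.2 h2]

/-- States are bounded; the optimal constant is `1`, but `2` suffices for compactness. -/
theorem norm_apply_le (x : X) : ‖φ x‖ ≤ 2 * ‖(x : B)‖ := by
  have h1 := (φ.norm_apply_le_of_isSelfAdjoint (isSelfAdjoint_rePart x)).trans (norm_rePart_le x)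
  have h2 := (φ.norm_apply_le_of_isSelfAdjoint (isSelfAdjoint_rePart (-(Complex.I • x)))).trans
    (norm_rePart_le _)
  simp only [Submodule.coe_neg, Submodule.coe_smul, norm_neg, norm_smul, Complex.norm_I,
    one_mul] at h2
  calc ‖φ x‖ = ‖φ (rePart x) + Complex.I * φ (rePart (-(Complex.I • x)))‖ := by
        rw [← map_smul, ← map_add, ← rePart_add_I_smul_rePart]
    _ ≤ _ := norm_add_le _ _
    _ ≤ _ := by
      rw [norm_mul, Complex.norm_I]
      linarith

theorem norm_apply_rePart_le (x : X) : ‖φ (rePart x)‖ ≤ ‖φ x‖ := by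
  have h1 := (φ.abs_re_le_of_isSelfAdjoint (isSelfAdjoint_rePart x)).2
  have h2 := (φ.abs_re_le_of_isSelfAdjoint (isSelfAdjoint_rePart (-(Complex.I • x)))).2
  have h : φ x = φ (rePart x) + Complex.I * φ (rePart (-(Complex.I • x))) := by
    rw [← map_smul, ← map_add, ← rePart_add_I_smul_rePart]
  have h3 : (φ x).re = (φ (rePart x)).re := by
    rw [h]
    simp [h2]
  rw [← Complex.abs_re_eq_norm.2 h1, ← h3]
  exact Complex.abs_re_le_norm _

end State

/-! ### Norming states -/

/-- The sublinear functional `x ↦ inf {r : Re x ≤ r}`. -/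
def maxRe (x : X) : ℝ := sInf {r : ℝ | (rePart x : B) ≤ algebraMap ℝ B r}

theorem rePart_add (x y : X) : (rePart (x + y) : B) = rePart x + rePart y := by
  simp only [rePart, Submodule.coe_smul, Submodule.coe_add, coe_star, star_add, smul_add]
  abel

theorem rePart_real_smul (c : ℝ) (x : X) : (rePart (c • x) : B) = c • (rePart x : B) := by
  simp only [rePart, Submodule.coe_smul, Submodule.coe_smul_of_tower, Submodule.coe_add, coe_star,
    star_smul, smul_add, star_trivial]
  simp only [smul_comm c]

theorem rePart_of_isSelfAdjoint {x : X} (hx : IsSelfAdjoint (x : B)) : (rePart x : B) = x := by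
  simp only [rePart, Submodule.coe_smul, Submodule.coe_add, coe_star, hx.star_eq, smul_add,
    ← add_smul]
  norm_num

theorem rePart_I_smul_of_isSelfAdjoint {x : X} (hx : IsSelfAdjoint (x : B)) :
    (rePart (Complex.I • x) : B) = 0 := by
  simp [rePart, hx.star_eq]

section Norming

variable [Nontrivial B]

theorem bddBelow_maxRe (x : X) : BddBelow {r : ℝ | (rePart x : B) ≤ algebraMap ℝ B r} := by
  refine ⟨-‖(rePart x : B)‖, fun r hr => ?_⟩
  have h := ((isSelfAdjoint_rePart x).neg_algebraMap_norm_le_self).trans hr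
  rw [← _root_.map_neg] at h
  exact (algebraMap_le_algebraMap).1 h

theorem maxRe_le {x : X} {r : ℝ} (h : (rePart x : B) ≤ algebraMap ℝ B r) : maxRe x ≤ r :=
  csInf_le (bddBelow_maxRe x) h

theorem le_maxRe {x : X} {r : ℝ} (h : ∀ s : ℝ, (rePart x : B) ≤ algebraMap ℝ B s → r ≤ s) :
    r ≤ maxRe x :=
  le_csInf ⟨_, (isSelfAdjoint_rePart x).le_algebraMap_norm_self⟩ h

theorem maxRe_add_le (x y : X) : maxRe (x + y) ≤ maxRe x + maxRe y := by
  rw [← sub_le_iff_le_add]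
  refine le_maxRe fun s hs => ?_
  rw [sub_le_comm]
  refine le_maxRe fun t ht => ?_
  rw [sub_le_iff_le_add']
  refine maxRe_le ?_
  rw [rePart_add, _root_.map_add]
  exact add_le_add hs ht

theorem maxRe_smul {c : ℝ} (hc : 0 < c) (x : X) : maxRe (c • x) = c * maxRe x := by
  have key : ∀ {c : ℝ}, 0 < c → ∀ x : X, maxRe (c • x) ≤ c * maxRe x := by
    intro c hc x
    rw [← div_le_iff₀' hc]
    refine le_maxRe fun s hs => ?_
    rw [div_le_iff₀' hc]
    refine maxRe_le ?_
    rw [rePart_real_smul, _root_.map_mul, ← Algebra.smul_def]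
    exact smul_le_smul_of_nonneg_left hs hc.le
  refine (key hc x).antisymm ?_
  have h := key (inv_pos.2 hc) (c • x)
  rwa [smul_smul, inv_mul_cancel₀ hc.ne', one_smul, ← div_eq_inv_mul, le_div_iff₀' hc] at h

/-- A point of the spectrum of a selfadjoint element is the value of a state. By Hahn–Banach, the
functional `t x ↦ t r` on the line through `x` has a real-linear extension which is dominated by
`maxRe`, and domination makes its complexification a state. -/
theorem exists_state_apply_eq {x : X} (hx : IsSelfAdjoint (x : B)) (hx0 : x ≠ 0) {r : ℝ}
    (hr : r ∈ spectrum ℝ (x : B)) : ∃ φ : X.State, φ x = r := by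
  obtain ⟨g, hg1, hg2⟩ := exists_extension_of_le_sublinear
    (LinearPMap.mkSpanSingleton (K := ℝ) x r hx0) (maxRe (X := X))
    (fun c hc y => maxRe_smul hc y) maxRe_add_le (by
      rintro ⟨y, hy⟩
      obtain ⟨t, rfl⟩ := Submodule.mem_span_singleton.1 hy
      rw [LinearPMap.mkSpanSingleton'_apply, RingHom.id_apply, smul_eq_mul]
      refine le_maxRe fun s hs => ?_
      rw [rePart_real_smul, rePart_of_isSelfAdjoint hx, ← sub_nonneg] at hs
      have h1 : s - t * r ∈ spectrum ℝ (algebraMap ℝ B s - t • (x : B)) := by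
        rw [← spectrum.singleton_sub_eq]
        refine Set.sub_mem_sub rfl ?_
        rcases eq_or_ne t 0 with rfl | ht
        · simp
        · obtain ⟨u, rfl⟩ : ∃ u : ℝˣ, t = u := ⟨Units.mk0 t ht, rfl⟩
          rw [← Units.smul_def, spectrum.unit_smul_eq_smul]
          exact Set.smul_mem_smul_set hr
      have h2 := spectrum_nonneg_of_nonneg hs h1
      simpa [sub_nonneg] using h2)
  have hgx : g x = r := by
    have := hg1 ⟨x, Submodule.mem_span_singleton_self x⟩
    rw [this]
    exact LinearPMap.mkSpanSingleton_apply ℝ ℝ hx0 r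
  have hle : ∀ {y : X} {s : ℝ}, (rePart y : B) ≤ algebraMap ℝ B s → g y ≤ s :=
    fun h => (hg2 _).trans (maxRe_le h)
  have hI : ∀ {y : X}, IsSelfAdjoint (y : B) → g (Complex.I • y) = 0 := by
    intro y hy
    refine le_antisymm (hle (by simp [rePart_I_smul_of_isSelfAdjoint hy])) ?_
    rw [← neg_nonpos, ← _root_.map_neg, ← smul_neg]
    refine hle ?_
    rw [rePart_I_smul_of_isSelfAdjoint (by simpa using hy.neg)]
    simp
  have h1 : g 1 = 1 := by
    have h1sa : IsSelfAdjoint ((1 : X) : B) := IsSelfAdjoint.one B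
    refine le_antisymm (hle (by simp [rePart_of_isSelfAdjoint h1sa])) ?_
    rw [← neg_le_neg_iff, ← _root_.map_neg]
    refine hle ?_
    rw [rePart_of_isSelfAdjoint (by simpa using h1sa.neg)]
    simp
  have hφ : ∀ {y : X}, IsSelfAdjoint (y : B) → Module.Dual.extendRCLike (𝕜 := ℂ) g y = g y := by
    intro y hy
    rw [Module.Dual.extendRCLike_apply]
    simp [hI hy]
  refine ⟨⟨Module.Dual.extendRCLike (𝕜 := ℂ) g, ?_, fun b hb => ?_⟩, ?_⟩
  · exact (hφ (IsSelfAdjoint.one B)).trans (by rw [h1]; simp)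
  · refine le_of_le_of_eq ?_ (hφ (y := ⟨star b * b, hb⟩) (IsSelfAdjoint.star_mul_self b)).symm
    rw [Complex.zero_le_real, ← neg_nonpos, ← _root_.map_neg]
    refine hle ?_
    rw [rePart_of_isSelfAdjoint (by simpa using (IsSelfAdjoint.star_mul_self b).neg)]
    simp [star_mul_self_nonneg]
  · exact (hφ hx).trans (by rw [hgx])

theorem exists_state_norm_apply_eq {x : X} (hx : IsSelfAdjoint (x : B)) :
    ∃ φ : X.State, ‖φ x‖ = ‖(x : B)‖ := by
  rcases eq_or_ne x 0 with rfl | hx0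
  · obtain ⟨φ, -⟩ := exists_state_apply_eq (X := X) (x := 1) (r := 1) (IsSelfAdjoint.one B)
      (fun h => one_ne_zero (congrArg Subtype.val h : (1 : B) = 0)) (by simp)
    exact ⟨φ, by simp⟩
  · rcases CStarAlgebra.norm_or_neg_norm_mem_spectrum hx with h | h
    · obtain ⟨φ, hφ⟩ := exists_state_apply_eq hx hx0 h
      exact ⟨φ, by simp [hφ]⟩
    · obtain ⟨φ, hφ⟩ := exists_state_apply_eq hx hx0 h
      exact ⟨φ, by simp [hφ]⟩

theorem nonempty_state : Nonempty X.State :=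
  ⟨(exists_state_norm_apply_eq (X := X) (x := 1) (IsSelfAdjoint.one B)).choose⟩

theorem norm_le_of_forall_state {x : X} {δ : ℝ} (h : ∀ φ : X.State, ‖φ x‖ ≤ δ) :
    ‖(x : B)‖ ≤ 2 * δ := by
  have key : ∀ {y : X}, (∀ φ : X.State, ‖φ y‖ ≤ δ) → ‖(rePart y : B)‖ ≤ δ := by
    intro y hy
    obtain ⟨φ, hφ⟩ := exists_state_norm_apply_eq (isSelfAdjoint_rePart y)
    exact hφ ▸ (φ.norm_apply_rePart_le y).trans (hy φ)
  have h1 := key h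
  have h2 : ‖(rePart (-(Complex.I • x)) : B)‖ ≤ δ := key fun φ => by
    have : φ (-(Complex.I • x)) = -(Complex.I * φ x) := by
      rw [← φ.map_smul]
      exact φ.toLinearMap.map_neg _
    rw [this, norm_neg, norm_mul, Complex.norm_I, one_mul]
    exact h φ
  calc ‖(x : B)‖ = ‖(rePart x : B) + Complex.I • (rePart (-(Complex.I • x)) : B)‖ := by
        conv_lhs => rw [rePart_add_I_smul_rePart x]
        simp
    _ ≤ _ := norm_add_le _ _
    _ ≤ _ := by
      rw [norm_smul, Complex.norm_I]
      linarith

end Norming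

variable (X) in
theorem isCompact_univ_state : @IsCompact _ (weakStarTopology X) Set.univ := by
  let := weakStarTopology X
  have hind : Topology.IsInducing fun φ : X.State => (φ : X → ℂ) := ⟨rfl⟩
  rw [hind.isCompact_iff, Set.image_univ]
  refine (isCompact_univ_pi fun x : X =>
    isCompact_closedBall (0 : ℂ) (2 * ‖(x : B)‖)).of_isClosed_subset
    ?_ ?_
  · have hrange : (Set.range fun φ : X.State => (φ : X → ℂ)) =
        {f : X → ℂ | (∀ x y, f (x + y) = f x + f y) ∧ (∀ (c : ℂ) (x : X), f (c • x) = c * f x) ∧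
          f 1 = 1 ∧ ∀ (b : B) (hb : star b * b ∈ X.toSubmodule), 0 ≤ f ⟨star b * b, hb⟩} := by
      ext f
      constructor
      · rintro ⟨φ, rfl⟩
        exact ⟨φ.map_add, φ.map_smul, φ.map_one, φ.nonneg'⟩
      · rintro ⟨h1, h2, h3, h4⟩
        exact ⟨⟨⟨⟨f, h1⟩, h2⟩, h3, h4⟩, rfl⟩
    rw [hrange]
    simp only [Set.ofPred_and, Set.ofPred_forall]
    refine (isClosed_iInter fun x => isClosed_iInter fun y => ?_).inter
      ((isClosed_iInter fun c => isClosed_iInter fun x => ?_).inter (IsClosed.inter ?_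
        (isClosed_iInter fun b => isClosed_iInter fun hb => ?_)))
    · exact isClosed_eq (by fun_prop) (by fun_prop)
    · exact isClosed_eq (by fun_prop) (by fun_prop)
    · exact isClosed_eq (by fun_prop) (by fun_prop)
    · exact isClosed_le continuous_const (by fun_prop)
  · rintro _ ⟨φ, rfl⟩ x -
    simpa using φ.norm_apply_le x

namespace State

/-- The convex combination `(1 - t) φ + t ψ` of two states. -/
def segment (φ ψ : X.State) {t : ℝ} (h0 : 0 ≤ t) (h1 : t ≤ 1) : X.State where
  toLinearMap := ((1 - t : ℝ) : ℂ) • φ.toLinearMap + (t : ℂ) • ψ.toLinearMap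
  map_one' := by
    change ((1 - t : ℝ) : ℂ) * φ 1 + (t : ℂ) * ψ 1 = 1
    rw [φ.map_one, ψ.map_one]
    push_cast
    ring
  nonneg' b hb := add_nonneg
    (mul_nonneg (Complex.zero_le_real.2 (sub_nonneg.2 h1)) (φ.nonneg' b hb))
      (mul_nonneg (Complex.zero_le_real.2 h0)
      (ψ.nonneg' b hb))

theorem segment_apply_sub (φ ψ : X.State) {t : ℝ} (h0 : 0 ≤ t) (h1 : t ≤ 1) (x : X) :
    segment φ ψ h0 h1 x - φ x = t * (ψ x - φ x) := by
  change ((1 - t : ℝ) : ℂ) * φ x + (t : ℂ) * ψ x - φ x = _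
  push_cast
  ring

end State

/-! ### Total boundedness and compact quantum metric spaces -/

variable {L : X → ℝ}

theorem norm_sub_le_of_mongeKantorovichDist_le {φ ψ : X.State} {ε : ℝ} (hε : 0 ≤ ε)
    (h : mongeKantorovichDist L φ ψ ≤ ENNReal.ofReal ε) {x : X} (hx : L x ≤ 1) :
    ‖φ x - ψ x‖ ≤ ε :=
  (ENNReal.ofReal_le_ofReal_iff hε).1 ((le_iSup₂_of_le x hx le_rfl).trans h)

/-- The Monge–Kantorovich distance of a compact quantum metric space is finite: the states
`(1 - t) φ + t ψ` converge to `φ` as `t → 0`, and their distance to `φ` is `t` times the distance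
of `ψ` to `φ`. -/
theorem mongeKantorovichDist_ne_top (h : IsCompactQuantumMetricSpace X L) (φ ψ : X.State) :
    mongeKantorovichDist L φ ψ ≠ ∞ := by
  let t : ℕ → ℝ := fun k => 1 / ((k : ℝ) + 1)
  have h0 : ∀ k, 0 ≤ t k := fun k => by positivity
  have h1 : ∀ k, t k ≤ 1 := fun k => by
    rw [div_le_one (by positivity)]
    linarith [(Nat.cast_nonneg k : (0 : ℝ) ≤ k)]
  have hweak : Tendsto (fun k => State.segment φ ψ (h0 k) (h1 k)) atTop
      (@nhds _ (weakStarTopology X) φ) := by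
    rw [nhds_induced, tendsto_comap_iff, tendsto_pi_nhds]
    intro x
    have h2 : Tendsto (fun k => (t k : ℂ) * (ψ x - φ x) + φ x) atTop
        (𝓝 ((0 : ℝ) * (ψ x - φ x) + φ x)) :=
      (((Complex.continuous_ofReal.tendsto 0).comp
        tendsto_one_div_add_atTop_nhds_zero_nat).mul_const _).add_const _
    rw [Complex.ofReal_zero, zero_mul, zero_add] at h2
    refine h2.congr fun k => ?_
    rw [← State.segment_apply_sub φ ψ (h0 k) (h1 k), sub_add_cancel]
    rfl
  rw [← h.metrizes] at hweak
  let := mongeKantorovich L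
  obtain ⟨k, hk⟩ := ((EMetric.tendsto_nhds.1 hweak) 1 one_pos).exists
  have hk' : mongeKantorovichDist L (State.segment φ ψ (h0 k) (h1 k)) φ ≤ ENNReal.ofReal 1 := by
    rw [ENNReal.ofReal_one]
    exact hk.le
  have htk : 0 < t k := by positivity
  refine ne_top_of_le_ne_top (b := ENNReal.ofReal (t k)⁻¹) ENNReal.ofReal_ne_top
    (iSup₂_le fun x hx => ENNReal.ofReal_le_ofReal ?_)
  have h3 := norm_sub_le_of_mongeKantorovichDist_le zero_le_one hk' hx
  rw [State.segment_apply_sub, norm_mul, Complex.norm_real, Real.norm_of_nonneg htk.le] at h3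
  rw [norm_sub_rev, ← one_div, le_div_iff₀' htk]
  exact h3

/-- In a compact quantum metric space, the set `{x : L x ≤ 1}` is totally bounded modulo scalars.
This is the argument of the Arzelà–Ascoli theorem: elements of this set are `1`-Lipschitz functions
on the state space, so they are determined up to `ε` by their values on a finite net of states. -/
theorem exists_finite_net (h : IsCompactQuantumMetricSpace X L) {ε : ℝ} (hε : 0 < ε) :
    ∃ F : Set X, F.Finite ∧ ∀ x, L x ≤ 1 → ∃ y ∈ F, ∃ c : ℂ, ‖(x : B) - y - c • (1 : B)‖ ≤ ε := by
  rcases subsingleton_or_nontrivial B with hB | hB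
  · exact ⟨{0}, Set.finite_singleton 0, fun x _ => ⟨0, rfl, 0, by
      rw [Subsingleton.elim ((x : B) - _ - _) 0, norm_zero]
      exact hε.le⟩⟩
  obtain ⟨φ₀⟩ := nonempty_state (X := X)
  set δ : ℝ := ε / 6 with hδ
  have hδ0 : 0 < δ := by positivity
  obtain ⟨T, hT, hcover⟩ : ∃ T : Set X.State, T.Finite ∧
      ∀ φ : X.State, ∃ ψ ∈ T, mongeKantorovichDist L φ ψ ≤ ENNReal.ofReal δ := by
    have hc := isCompact_univ_state X
    rw [← h.metrizes] at hc
    let := mongeKantorovich L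
    obtain ⟨T, hT, hcover⟩ := EMetric.totallyBounded_iff.1 hc.totallyBounded (ENNReal.ofReal δ)
      (ENNReal.ofReal_pos.2 hδ0)
    refine ⟨T, hT, fun φ => ?_⟩
    obtain ⟨ψ, hψ, hφ⟩ := Set.mem_iUnion₂.1 (hcover (Set.mem_univ φ))
    exact ⟨ψ, hψ, le_of_lt hφ⟩
  have : Fintype T := hT.fintype
  -- the values at the net of states, normalised at `φ₀`
  let ev : X → T → ℂ := fun x ψ => ψ.1 x - φ₀ x
  have hbdd : Bornology.IsBounded (ev '' {x | L x ≤ 1}) := by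
    refine Bornology.forall_isBounded_image_eval_iff.1 fun ψ => ?_
    refine isBounded_iff_forall_norm_le.2
      ⟨(mongeKantorovichDist L ψ.1 φ₀).toReal, ?_⟩
    rintro _ ⟨_, ⟨x, hx, rfl⟩, rfl⟩
    exact norm_sub_le_of_mongeKantorovichDist_le ENNReal.toReal_nonneg
      (ENNReal.ofReal_toReal (mongeKantorovichDist_ne_top h _ _)).ge hx
  obtain ⟨t, htsub, htfin, htcover⟩ := Metric.finite_approx_of_totallyBounded
    (hbdd.isCompact_closure.totallyBounded.subset subset_closure) δ hδ0
  obtain ⟨F, hFsub, hFfin, rfl⟩ := (Set.exists_subset_image_finite_and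
    (p := fun u => u = t)).1 ⟨t, htsub, htfin, rfl⟩
  refine ⟨F, hFfin, fun x hx => ?_⟩
  obtain ⟨_, ⟨y, hy, rfl⟩, hxy⟩ := Set.mem_iUnion₂.1 (htcover ⟨x, hx, rfl⟩)
  refine ⟨y, hy, φ₀ (x - y), ?_⟩
  have key : ∀ φ : X.State, ‖φ (x - y - φ₀ (x - y) • (1 : X))‖ ≤ 3 * δ := by
    intro φ
    obtain ⟨ψ, hψT, hψ⟩ := hcover φ
    have h1 := norm_sub_le_of_mongeKantorovichDist_le hδ0.le hψ hx
    have h2 := norm_sub_le_of_mongeKantorovichDist_le hδ0.le hψ (hFsub hy)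
    have h3 : ‖ev x ⟨ψ, hψT⟩ - ev y ⟨ψ, hψT⟩‖ ≤ δ := by
      rw [← dist_eq_norm]
      exact (dist_le_pi_dist (ev x) (ev y) ⟨ψ, hψT⟩).trans (le_of_lt hxy)
    have h4 : φ (x - y - φ₀ (x - y) • (1 : X)) =
        (φ x - ψ x) - (φ y - ψ y) + (ev x ⟨ψ, hψT⟩ - ev y ⟨ψ, hψT⟩) := by
      simp only [State.map_sub, State.map_smul, State.map_one, ev]
      ring
    rw [h4]
    have h5 := norm_add_le ((φ x - ψ x) - (φ y - ψ y)) (ev x ⟨ψ, hψT⟩ - ev y ⟨ψ, hψT⟩)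
    have h6 := norm_sub_le (φ x - ψ x) (φ y - ψ y)
    linarith
  have h7 := norm_le_of_forall_state key
  simp only [Submodule.coe_sub, Submodule.coe_smul, coe_one] at h7
  linarith

/-- The converse of `exists_finite_net`: a slip-norm whose unit ball is totally bounded modulo
scalars defines a compact quantum metric space. -/
theorem isCompactQuantumMetricSpace_of_finite_net (hL : IsSlipNorm L)
    (h : ∀ ε > 0, ∃ F : Set X, F.Finite ∧
      ∀ x, L x ≤ 1 → ∃ y ∈ F, ∃ c : ℂ, ‖(x : B) - y - c • (1 : B)‖ ≤ ε) :
    IsCompactQuantumMetricSpace X L := by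
  refine ⟨hL, le_antisymm ?_ ?_⟩
  · -- evaluation at `x` is Lipschitz with constant `L x + 1`
    rw [← continuous_iff_le_induced]
    let := mongeKantorovich L
    refine continuous_pi fun x => ?_
    have hM : 0 < L x + 1 := by linarith [hL.nonneg x]
    refine LipschitzWith.continuous (K := (L x + 1).toNNReal) fun φ ψ => ?_
    change edist (φ x) (ψ x) ≤ ((L x + 1).toNNReal : ℝ≥0∞) * mongeKantorovichDist L φ ψ
    have hx : L (((L x + 1 : ℝ) : ℂ)⁻¹ • x) ≤ 1 := by
      rw [hL.smul, norm_inv, Complex.norm_real, Real.norm_of_nonneg hM.le, inv_mul_le_one₀ hM]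
      linarith
    refine le_trans ?_ (mul_le_mul_right
      (le_iSup₂ (f := fun (x : X) (_ : L x ≤ 1) => ENNReal.ofReal ‖φ x - ψ x‖) _ hx) _)
    rw [edist_dist, dist_eq_norm, State.map_smul, State.map_smul, ← mul_sub, norm_mul, norm_inv,
      Complex.norm_real, Real.norm_of_nonneg hM.le, ← ENNReal.ofReal, ← ENNReal.ofReal_mul hM.le,
      mul_inv_cancel_left₀ hM.ne']
  · refine le_of_nhds_le_nhds fun φ => ?_
    have hbasis := @Metric.nhds_basis_eball _ (mongeKantorovich L) φ
    refine hbasis.ge_iff.2 fun ε hε => ?_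
    obtain ⟨δ, hδ0, hδ⟩ : ∃ δ : ℝ, 0 < δ ∧ ENNReal.ofReal (6 * δ) < ε := by
      obtain ⟨r, hr0, hr⟩ := ENNReal.lt_iff_exists_nnreal_btwn.1 hε
      have hr0' : 0 < (r : ℝ) := by exact_mod_cast hr0
      refine ⟨r / 6, by positivity, ?_⟩
      rwa [mul_div_cancel₀ _ (by norm_num), ENNReal.ofReal_coe_nnreal]
    obtain ⟨F, hF, hnet⟩ := h δ hδ0
    have hnhds : {ψ : X.State | ∀ y ∈ F, ‖ψ y - φ y‖ < δ} ∈ @nhds _ (weakStarTopology X) φ := by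
      have : {ψ : X.State | ∀ y ∈ F, ‖ψ y - φ y‖ < δ} =
          ⋂ y ∈ F, {ψ : X.State | ‖ψ y - φ y‖ < δ} := by
        ext
        simp
      rw [this, Filter.biInter_mem hF, nhds_induced]
      intro y _
      refine ⟨{f | ‖f y - φ y‖ < δ}, ?_, fun ψ hψ => hψ⟩
      refine (isOpen_lt (by fun_prop) continuous_const).mem_nhds ?_
      simpa using hδ0
    refine Filter.mem_of_superset hnhds fun ψ hψ => lt_of_le_of_lt ?_ hδ
    change mongeKantorovichDist L ψ φ ≤ _
    refine iSup₂_le fun x hx => ENNReal.ofReal_le_ofReal ?_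
    obtain ⟨y, hy, c, hc⟩ := hnet x hx
    have h1 : ψ x - φ x = (ψ y - φ y) + ψ (x - y - c • (1 : X)) - φ (x - y - c • (1 : X)) := by
      simp only [State.map_sub, State.map_smul, State.map_one]
      ring
    have h2 : ∀ χ : X.State, ‖χ (x - y - c • (1 : X))‖ ≤ 2 * δ := fun χ =>
      (χ.norm_apply_le _).trans (mul_le_mul_of_nonneg_left hc zero_le_two)
    rw [h1]
    have h3 := norm_sub_le ((ψ y - φ y) + ψ (x - y - c • (1 : X))) (φ (x - y - c • (1 : X)))
    have h4 := norm_add_le (ψ y - φ y) (ψ (x - y - c • (1 : X)))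
    linarith [h2 ψ, h2 φ, hψ y hy]

end OperatorSystem

end States

/-! ### Almost invariant vectors of amenable groups -/

section Amenable

variable {Γ : Type*} [Group Γ]

open scoped Classical in
/-- The embedding of the finitely supported functions into `ℓ¹(Γ)`. -/
def finsuppToL1 : (Γ →₀ ℝ) →ₗ[ℝ] lp (fun _ : Γ => ℝ) 1 :=
  Finsupp.linearCombination ℝ fun s => lp.single 1 s (1 : ℝ)

open scoped Classical in
theorem finsuppToL1_single (s : Γ) (c : ℝ) :
    finsuppToL1 (Finsupp.single s c) = c • lp.single 1 s (1 : ℝ) := by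
  rw [finsuppToL1, Finsupp.linearCombination_single]

theorem finsuppToL1_apply (f : Γ →₀ ℝ) (s : Γ) : finsuppToL1 f s = f s := by
  classical
  induction f using Finsupp.induction_linear with
  | zero => simp
  | add f h hf hh => rw [map_add, lp.coeFn_add, Pi.add_apply, hf, hh, Finsupp.add_apply]
  | single t c =>
    rw [finsuppToL1_single, lp.coeFn_smul, Pi.smul_apply, lp.single_apply, Finsupp.single_apply]
    by_cases h : t = s
    · subst h; simp
    · rw [if_neg h, Pi.single_eq_of_ne (Ne.symm h), smul_zero]

theorem norm_finsuppToL1 (f : Γ →₀ ℝ) : ‖finsuppToL1 f‖ = ∑' s, |f s| := by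
  rw [lp.norm_eq_tsum_rpow (by norm_num)]
  simp [finsuppToL1_apply]

/-- Left translation of finitely supported functions, `(g · f)(s) = f(g⁻¹ s)`. -/
def leftTranslate (g : Γ) : (Γ →₀ ℝ) →ₗ[ℝ] (Γ →₀ ℝ) := Finsupp.lmapDomain ℝ ℝ (g * ·)

theorem leftTranslate_apply (g : Γ) (f : Γ →₀ ℝ) (s : Γ) : leftTranslate g f s = f (g⁻¹ * s) := by
  have h : s = g * (g⁻¹ * s) := by simp
  conv_lhs => rw [h]
  exact Finsupp.mapDomain_apply (mul_right_injective g) _ _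

/-- Reiter's condition: an amenable group has finitely supported probability measures that are
almost invariant in `ℓ¹`. Otherwise Hahn–Banach separates `0` from the differences `g μ - μ`; the
separating functional is given by bounded functions `h g`, and `∑ g, (h g (g s) - h g s)` is bounded
below by a positive constant although its invariant mean is zero. -/
theorem IsAmenable.exists_almost_invariant (hΓ : IsAmenable Γ) (F : Finset Γ) {ε : ℝ}
    (hε : 0 < ε) : ∃ μ : Γ →₀ ℝ, (∀ s, 0 ≤ μ s) ∧ ∑' s, μ s = 1 ∧
      ∀ g ∈ F, ∑' s, |μ (g⁻¹ * s) - μ s| ≤ ε := by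
  classical
  let T : (Γ →₀ ℝ) →ₗ[ℝ] (F → lp (fun _ : Γ => ℝ) 1) :=
    LinearMap.pi fun g => finsuppToL1 ∘ₗ (leftTranslate g.1 - LinearMap.id)
  let P : Set (Γ →₀ ℝ) :=
    {μ | (∀ s, 0 ≤ μ s) ∧ Finsupp.linearCombination ℝ (fun _ => (1 : ℝ)) μ = 1}
  have hP : Convex ℝ P := by
    rintro μ ⟨h1, h2⟩ ν ⟨h3, h4⟩ a b ha hb hab
    refine ⟨fun s => ?_, ?_⟩
    · exact add_nonneg (mul_nonneg ha (h1 s)) (mul_nonneg hb (h3 s))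
    · rw [map_add, map_smul, map_smul, h2, h4]
      simpa using hab
  have h0 : (0 : F → lp (fun _ : Γ => ℝ) 1) ∈ closure (T '' P) := by
    by_contra hmem
    obtain ⟨f, u, hu, hf⟩ := geometric_hahn_banach_point_closed
      (hP.linear_image T).closure isClosed_closure hmem
    rw [map_zero] at hu
    let h : F → Γ → ℝ := fun g s => f (Pi.single g (lp.single 1 s (1 : ℝ)))
    have hbdd : ∀ g, h g ∈ boundedFunctions Γ := fun g => ⟨‖f‖, fun s => by
      refine (f.le_opNorm _).trans ?_
      rw [Pi.norm_single, lp.norm_single (by norm_num)]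
      simp⟩
    obtain ⟨m, hm0, hm1, hminv⟩ := hΓ
    have htr : ∀ g : F, (fun s => h g (g.1 * s)) ∈ boundedFunctions Γ := fun g => by
      obtain ⟨C, hC⟩ := hbdd g
      exact ⟨C, fun s => hC _⟩
    let D : boundedFunctions Γ := ∑ g : F, (⟨_, htr g⟩ - ⟨_, hbdd g⟩)
    have hD0 : m D = 0 := by
      rw [map_sum]
      refine Finset.sum_eq_zero fun g _ => ?_
      rw [map_sub, hminv g.1⁻¹ ⟨_, hbdd g⟩ ⟨_, htr g⟩ (fun s => by simp), sub_self]
    have hDs : ∀ s, D.1 s = f (T (Finsupp.single s 1)) := by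
      intro s
      have hT : T (Finsupp.single s 1) = ∑ g : F, (Pi.single g (lp.single 1 (g.1 * s) (1 : ℝ)) -
          Pi.single g (lp.single 1 s (1 : ℝ))) := by
        funext g
        rw [Finset.sum_apply, Finset.sum_eq_single g]
        · simp [T, leftTranslate, Finsupp.mapDomain_single, finsuppToL1_single]
        · intro g' _ hg'
          simp [Pi.single_eq_of_ne (Ne.symm hg')]
        · simp
      rw [hT, map_sum]
      simp [D, h]
    have hpos : 0 ≤ m (D - u • ⟨fun _ => 1, 1, by simp⟩) := by
      refine hm0 _ fun s => ?_
      have h3 := (hf _ (subset_closure ⟨Finsupp.single s 1, ⟨fun t => ?_, by simp⟩, rfl⟩)).le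
      · rw [← hDs] at h3
        simpa using h3
      · rw [Finsupp.single_apply]
        split_ifs <;> norm_num
    rw [map_sub, hD0, map_smul, hm1 _ (fun _ => rfl)] at hpos
    simp only [smul_eq_mul, mul_one, zero_sub] at hpos
    linarith
  obtain ⟨_, ⟨μ, ⟨h1, h2⟩, rfl⟩, hμ⟩ := Metric.mem_closure_iff.1 h0 ε hε
  refine ⟨μ, h1, ?_, fun g hg => ?_⟩
  · rw [← h2, Finsupp.linearCombination_apply, Finsupp.sum,
      tsum_eq_sum (s := μ.support) (fun s hs => by simpa using hs)]
    simp
  · rw [dist_comm, dist_zero_right] at hμ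
    have h3 := (norm_le_pi_norm (T μ) ⟨g, hg⟩).trans hμ.le
    change ‖finsuppToL1 (leftTranslate g μ - μ)‖ ≤ ε at h3
    rw [norm_finsuppToL1] at h3
    simpa [leftTranslate_apply] using h3

/-- The positive-definite function `g ↦ ⟪ξ, λ_g ξ⟫` of a vector `ξ ∈ ℓ²(Γ)`. -/
def matrixCoeff (ξ : L2 Γ ℂ) (g : Γ) : ℂ := ∑' s, star (ξ s) * ξ (g⁻¹ * s)

/-- Almost invariant vectors in `ℓ²(Γ)`, obtained as square roots of almost invariant probability
measures. -/
theorem IsAmenable.exists_matrixCoeff_near_one (hΓ : IsAmenable Γ) (F : Finset Γ) {ε : ℝ}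
    (hε : 0 < ε) : ∃ ξ : L2 Γ ℂ, {s | ξ s ≠ 0}.Finite ∧ matrixCoeff ξ 1 = 1 ∧
      ∀ g ∈ F, ‖matrixCoeff ξ g - 1‖ ≤ ε := by
  obtain ⟨μ, hμ0, hμ1, hμ⟩ := hΓ.exists_almost_invariant F hε
  have hsupp : {s | ((√(μ s) : ℝ) : ℂ) ≠ 0}.Finite :=
    μ.hasFiniteSupport.subset fun s hs h => hs (by simp [h])
  have hsq : ∀ s, √(μ s) * √(μ s) = μ s := fun s => Real.mul_self_sqrt (hμ0 s)
  have hcoeff : ∀ g, matrixCoeff (L2.ofFinite _ hsupp) g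
      = ((∑' s, √(μ s) * √(μ (g⁻¹ * s)) : ℝ) : ℂ) := by
    intro g
    rw [Complex.ofReal_tsum]
    refine tsum_congr fun s => ?_
    simp
  refine ⟨L2.ofFinite _ hsupp, hsupp, ?_, fun g hg => ?_⟩
  · rw [hcoeff]
    simp [hsq, hμ1]
  · have hs1 : Summable μ := summable_of_hasFiniteSupport μ.hasFiniteSupport
    have hs2 : Summable fun s => μ (g⁻¹ * s) := ((Equiv.mulLeft g⁻¹).summable_iff).2 hs1
    have hs3 : Summable fun s => √(μ s) * √(μ (g⁻¹ * s)) :=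
      summable_of_hasFiniteSupport (μ.hasFiniteSupport.subset fun s hs h => hs (by simp [h]))
    have hμ2 : ∑' s, μ (g⁻¹ * s) = 1 := ((Equiv.mulLeft g⁻¹).tsum_eq μ).trans hμ1
    have key : 1 - ∑' s, √(μ s) * √(μ (g⁻¹ * s))
        = ∑' s, (√(μ (g⁻¹ * s)) - √(μ s)) ^ 2 / 2 := by
      have h : ∀ s, (√(μ (g⁻¹ * s)) - √(μ s)) ^ 2 / 2
          = (1 / 2) * μ s + (1 / 2) * μ (g⁻¹ * s) - √(μ s) * √(μ (g⁻¹ * s)) := by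
        intro s
        rw [← hsq s, ← hsq (g⁻¹ * s)]
        simp only [Real.sqrt_mul_self (Real.sqrt_nonneg _)]
        ring
      simp only [h]
      rw [((hs1.mul_left _).add (hs2.mul_left _)).tsum_sub hs3,
        (hs1.mul_left _).tsum_add (hs2.mul_left _), tsum_mul_left, tsum_mul_left, hμ1, hμ2]
      norm_num
    have hle : ∀ s, (√(μ (g⁻¹ * s)) - √(μ s)) ^ 2 / 2 ≤ |μ (g⁻¹ * s) - μ s| := by
      intro s
      rw [← hsq s, ← hsq (g⁻¹ * s)]
      simp only [Real.sqrt_mul_self (Real.sqrt_nonneg _)]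
      have ha := Real.sqrt_nonneg (μ (g⁻¹ * s))
      have hb := Real.sqrt_nonneg (μ s)
      generalize √(μ (g⁻¹ * s)) = a at ha ⊢
      generalize √(μ s) = b at hb ⊢
      rcases le_total a b with hab | hab
      · rw [abs_of_nonpos (by nlinarith)]
        nlinarith [mul_nonneg ha (sub_nonneg.2 hab), sq_nonneg (b - a)]
      · rw [abs_of_nonneg (by nlinarith)]
        nlinarith [mul_nonneg hb (sub_nonneg.2 hab), sq_nonneg (b - a)]
    have hs4 : Summable fun s => |μ (g⁻¹ * s) - μ s| := (hs2.sub hs1).abs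
    have hs5 := Summable.of_nonneg_of_le (fun s => by positivity) hle hs4
    rw [hcoeff, ← Complex.ofReal_one, ← Complex.ofReal_sub, Complex.norm_real, norm_sub_rev, key,
      Real.norm_of_nonneg (tsum_nonneg fun s => by positivity)]
    exact (hs5.tsum_le_tsum hle hs4).trans (hμ g hg)

theorem finite_support_matrixCoeff {ξ : L2 Γ ℂ} (hξ : {s | ξ s ≠ 0}.Finite) :
    (Function.support (matrixCoeff ξ)).Finite := by
  refine (hξ.image2 (fun s t => s * t⁻¹) hξ).subset fun g hg => ?_
  obtain ⟨s, hs⟩ : ∃ s, star (ξ s) * ξ (g⁻¹ * s) ≠ 0 := by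
    by_contra! h
    exact hg (by simp only [matrixCoeff, h, tsum_zero])
  refine ⟨s, ?_, g⁻¹ * s, right_ne_zero_of_mul hs, by simp⟩
  intro h
  exact left_ne_zero_of_mul hs (by simp [h])

/-! ### The trivial state of the group algebra -/

/-- The multiple `c λ_g` of a canonical unitary, as an element of the group algebra. -/
def groupElem (c : ℂ) (g : Γ) : groupAlgebra Γ :=
  ⟨gen (trivialAction Γ) c g, Submodule.subset_span ⟨c, Submodule.mem_top, g, rfl⟩⟩

/-- The vector state of `ξ ∈ ℓ²(Γ)` on the group algebra. -/
def vectorState (ξ : L2 Γ ℂ) (hξ : matrixCoeff ξ 1 = 1) : (groupAlgebra Γ).State where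
  toFun f := (inner ℂᵐᵒᵖ ξ (f.1.toOp ξ)).unop
  map_add' f h := by
    change (inner ℂᵐᵒᵖ ξ (f.1.toOp ξ + h.1.toOp ξ)).unop = _
    rw [CStarModule.inner_add_right, unop_add]
  map_smul' c f := by
    change (inner ℂᵐᵒᵖ ξ (c • f.1.toOp ξ)).unop = _
    rw [CStarModule.inner_smul_right_complex, unop_smul]
    rfl
  map_one' := by
    change ∑' s, star (ξ s) * ξ s = 1
    simpa [matrixCoeff] using hξ
  nonneg' b hb := by
    have h : inner ℂᵐᵒᵖ ξ (star b.toOp (b.toOp ξ)) = inner ℂᵐᵒᵖ (b.toOp ξ) (b.toOp ξ) :=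
      Adjointable.inner_star_right _ _ _
    change 0 ≤ (inner ℂᵐᵒᵖ ξ (star b.toOp (b.toOp ξ))).unop
    rw [h]
    exact unop_nonneg.2 CStarModule.inner_self_nonneg

theorem vectorState_groupElem (ξ : L2 Γ ℂ) (hξ : matrixCoeff ξ 1 = 1) (c : ℂ) (g : Γ) :
    vectorState ξ hξ (groupElem c g) = c * matrixCoeff ξ g := by
  change ∑' s, star (ξ s) * (c * ξ (g⁻¹ * s)) = _
  rw [matrixCoeff, ← tsum_mul_left]
  exact tsum_congr fun s => by ring

/-- For an amenable group, the trivial state `λ_g ↦ 1` of the group algebra is approximated in the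
Monge–Kantorovich metric by states `λ_g ↦ φ(g)` with `φ` finitely supported. The trivial state is
obtained as a cluster point of vector states, which exists because the state space is compact. -/
theorem IsAmenable.exists_finsupp_near_trivial (hΓ : IsAmenable Γ) {L : groupAlgebra Γ → ℝ}
    (hL : IsCompactQuantumMetricSpace (groupAlgebra Γ) L) {ε : ℝ} (hε : 0 < ε) :
    ∃ φ : Γ →₀ ℂ, φ 1 = 1 ∧ ∀ (S : Finset Γ) (c : Γ → ℂ), L (∑ g ∈ S, groupElem (c g) g) ≤ 1 →
      ‖∑ g ∈ S, (1 - φ g) * c g‖ ≤ ε := by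
  classical
  have hex : ∀ i : Finset Γ × ℕ, ∃ ξ : L2 Γ ℂ, {s | ξ s ≠ 0}.Finite ∧ matrixCoeff ξ 1 = 1 ∧
      ∀ g ∈ i.1, ‖matrixCoeff ξ g - 1‖ ≤ 1 / ((i.2 : ℝ) + 1) :=
    fun i => hΓ.exists_matrixCoeff_near_one i.1 (by positivity)
  choose ξ hfin hone hnear using hex
  let Φ : Finset Γ × ℕ → (groupAlgebra Γ).State := fun i => vectorState (ξ i) (hone i)
  have htend : ∀ g, Tendsto (fun i => matrixCoeff (ξ i) g) atTop (𝓝 1) := by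
    intro g
    rw [← tendsto_sub_nhds_zero_iff]
    have h1 : Tendsto (fun i : Finset Γ × ℕ => 1 / ((i.2 : ℝ) + 1)) atTop (𝓝 0) := by
      rw [← prod_atTop_atTop_eq]
      exact tendsto_one_div_add_atTop_nhds_zero_nat.comp tendsto_snd
    refine squeeze_zero_norm' ?_ h1
    filter_upwards [eventually_ge_atTop (({g} : Finset Γ), 0)] with i hi
    exact hnear i g (hi.1 (Finset.mem_singleton_self g))
  let U : Ultrafilter (Finset Γ × ℕ) := Ultrafilter.of atTop
  have hU : (U : Filter (Finset Γ × ℕ)) ≤ atTop := Ultrafilter.of_le _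
  obtain ⟨χ, -, hχ⟩ := @IsCompact.ultrafilter_le_nhds _ (weakStarTopology (groupAlgebra Γ)) _
    (OperatorSystem.isCompact_univ_state _) (U.map Φ) (by simp)
  have hχ' : Tendsto Φ U (@nhds _ (weakStarTopology (groupAlgebra Γ)) χ) := hχ
  have hχ1 : ∀ c g, χ (groupElem c g) = c := by
    intro c g
    have h1 := hχ'
    rw [nhds_induced, tendsto_comap_iff, tendsto_pi_nhds] at h1
    refine tendsto_nhds_unique (h1 (groupElem c g)) ?_
    have h2 := ((htend g).mono_left hU).const_mul c
    rw [mul_one] at h2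
    exact h2.congr fun i => (vectorState_groupElem _ (hone i) c g).symm
  rw [← hL.metrizes] at hχ'
  let := mongeKantorovich L
  obtain ⟨i, hi⟩ :=
    ((EMetric.tendsto_nhds.1 hχ') (ENNReal.ofReal ε) (ENNReal.ofReal_pos.2 hε)).exists
  have hi' : mongeKantorovichDist L (Φ i) χ ≤ ENNReal.ofReal ε := le_of_lt hi
  refine ⟨Finsupp.ofSupportFinite _ (finite_support_matrixCoeff (hfin i)), hone i,
    fun S c hS => ?_⟩
  have h1 := OperatorSystem.norm_sub_le_of_mongeKantorovichDist_le hε.le hi' hS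
  rw [OperatorSystem.State.map_sum, OperatorSystem.State.map_sum, norm_sub_rev,
    ← Finset.sum_sub_distrib] at h1
  refine le_of_eq_of_le (congrArg norm (Finset.sum_congr rfl fun g _ => ?_)) h1
  rw [hχ1, vectorState_groupElem]
  change (1 - matrixCoeff (ξ i) g) * c g = _
  ring

end Amenable

/-! ### Operators on `ℓ²(Γ, A) ⊗ ℂⁿ` -/

section Operators

variable {I Γ A : Type*} [Group Γ] [CStarAlgebra A] [PartialOrder A] [StarOrderedRing A] {n : ℕ}

open scoped WithCStarModule

theorem star_smul_mul_smul (c : ℂ) (a : A) :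
    star (c • a) * (c • a) = ((‖c‖ ^ 2 : ℝ) : ℂ) • (star a * a) := by
  rw [star_smul, smul_mul_smul_comm, Complex.ofReal_pow, ← Complex.conj_mul', RCLike.star_def]

theorem ofReal_smul_le_smul {a : A} (ha : 0 ≤ a) {r s : ℝ} (h : r ≤ s) :
    (r : ℂ) • a ≤ (s : ℂ) • a := by
  rw [Complex.coe_smul, Complex.coe_smul]
  exact smul_le_smul_of_nonneg_right h ha

theorem L2.sum_apply {ι : Type*} (s : Finset ι) (f : ι → L2 I A) (i : I) :
    (∑ j ∈ s, f j : L2 I A) i = ∑ j ∈ s, f j i := by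
  classical
  induction s using Finset.induction_on with
  | empty => simp
  | insert j s hj ih => rw [Finset.sum_insert hj, Finset.sum_insert hj, L2.add_apply, ih]

/-- Pointwise multiplication by a scalar function bounded by `C`, on families in `ℓ²(I, A)`. -/
def mulLin {m : I → ℂ} {C : ℝ} (hm : ∀ i, ‖m i‖ ≤ C) : L2 I A →ₗ[ℂ] L2 I A where
  toFun f := L2.mk (fun i => m i • f i) <| by
    refine summable_of_nonneg_of_le_cstar (fun i => star_mul_self_nonneg _) (fun i => ?_)
      (f.summable_self.const_smul ((C ^ 2 : ℝ) : ℂ))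
    rw [star_smul_mul_smul]
    exact ofReal_smul_le_smul (star_mul_self_nonneg _) (pow_le_pow_left₀ (norm_nonneg _) (hm i) 2)
  map_add' f h := by ext t; simp
  map_smul' c f := by ext t; simp [smul_comm c]

theorem norm_mulLin_le {m : I → ℂ} {C : ℝ} (hm : ∀ i, ‖m i‖ ≤ C) (f : L2 I A) :
    ‖mulLin hm f‖ ≤ |C| * ‖f‖ := by
  refine L2.norm_le_of_sum_le _ (by positivity) fun s => ?_
  have h : ∑ i ∈ s, star (mulLin hm f i) * mulLin hm f i
      ≤ ((C ^ 2 : ℝ) : ℂ) • ∑ i ∈ s, star (f i) * f i := by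
    rw [Finset.smul_sum]
    refine Finset.sum_le_sum fun i _ => ?_
    change star (m i • f i) * (m i • f i) ≤ _
    rw [star_smul_mul_smul]
    exact ofReal_smul_le_smul (star_mul_self_nonneg _) (pow_le_pow_left₀ (norm_nonneg _) (hm i) 2)
  refine (CStarAlgebra.norm_le_norm_of_nonneg_of_le
    (Finset.sum_nonneg fun i _ => star_mul_self_nonneg _) h).trans ?_
  rw [norm_smul, mul_pow, Complex.norm_real, Real.norm_of_nonneg (by positivity), sq_abs]
  gcongr
  exact L2.norm_sum_le f _

/-- Multiplication by a bounded scalar function, as an adjointable operator. -/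
def mulOp {m : I → ℂ} {C : ℝ} (hm : ∀ i, ‖m i‖ ≤ C) : Adjointable Aᵐᵒᵖ (L2 I A) :=
  Adjointable.mk ((mulLin hm).mkContinuous |C| (norm_mulLin_le hm))
    ((mulLin (m := fun i => star (m i)) (C := C) (by simpa using hm)).mkContinuous |C|
      (norm_mulLin_le _)) fun f h => by
      simp only [L2.inner_def, LinearMap.mkContinuous_apply]
      congr 1
      refine tsum_congr fun i => ?_
      change star (star (m i) • f i) * h i = star (f i) * (m i • h i)
      rw [star_smul, star_star, smul_mul_assoc, mul_smul_comm]

@[simp] theorem mulOp_apply {m : I → ℂ} {C : ℝ} (hm : ∀ i, ‖m i‖ ≤ C) (f : L2 I A) (i : I) :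
    mulOp hm f i = m i • f i := rfl

theorem star_mulOp {m : I → ℂ} {C : ℝ} (hm : ∀ i, ‖m i‖ ≤ C) :
    star (mulOp hm : Adjointable Aᵐᵒᵖ (L2 I A)) =
      mulOp (m := fun i => star (m i)) (C := C) (by simpa using hm) := by
  refine (Adjointable.eq_star_of_inner fun f h => ?_).symm
  simp only [L2.inner_def, mulOp_apply]
  congr 1
  refine tsum_congr fun i => ?_
  rw [star_smul, smul_mul_assoc, mul_smul_comm]

/-- The operator on `ℓ²(Γ, A) ⊗ ℂⁿ` given by a matrix of operators on `ℓ²(Γ, A)`. -/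
def ofMatrix (T : Fin n → Fin n → Adjointable Aᵐᵒᵖ (L2 Γ A)) : Adjointable Aᵐᵒᵖ (L2n Γ A n) :=
  let op (S : Fin n → Fin n → Adjointable Aᵐᵒᵖ (L2 Γ A)) : L2n Γ A n →L[ℂ] L2n Γ A n :=
    (WithCStarModule.equivL (R := ℂ) (A := Aᵐᵒᵖ) (E := Fin n → L2 Γ A)).symm.toContinuousLinearMap ∘L
      (ContinuousLinearMap.pi fun i => ∑ j, (S i j).toCLM ∘L ContinuousLinearMap.proj j) ∘L
      (WithCStarModule.equivL (R := ℂ) (A := Aᵐᵒᵖ) (E := Fin n → L2 Γ A)).toContinuousLinearMap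
  have hop (S : Fin n → Fin n → Adjointable Aᵐᵒᵖ (L2 Γ A)) (ζ : L2n Γ A n) (i : Fin n) :
      op S ζ i = ∑ j, S i j (ζ j) := by
    change (∑ j, (S i j).toCLM ∘L ContinuousLinearMap.proj j) _ = _
    rw [_root_.sum_apply]
    rfl
  Adjointable.mk (op T) (op fun i j => star (T j i)) fun ζ ξ => by
    simp only [WithCStarModule.pi_inner, hop, CStarModule.inner_sum_left,
      CStarModule.inner_sum_right, Adjointable.inner_star_left]
    exact Finset.sum_comm

@[simp] theorem ofMatrix_apply (T : Fin n → Fin n → Adjointable Aᵐᵒᵖ (L2 Γ A)) (ζ : L2n Γ A n)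
    (i : Fin n) : ofMatrix T ζ i = ∑ j, T i j (ζ j) := by
  change (∑ j, (T i j).toCLM ∘L ContinuousLinearMap.proj j) _ = _
  rw [_root_.sum_apply]
  rfl

theorem star_ofMatrix (T : Fin n → Fin n → Adjointable Aᵐᵒᵖ (L2 Γ A)) :
    star (ofMatrix T) = ofMatrix fun i j => star (T j i) := by
  refine (Adjointable.eq_star_of_inner fun ζ ξ => ?_).symm
  simp only [WithCStarModule.pi_inner, ofMatrix_apply, CStarModule.inner_sum_left,
    CStarModule.inner_sum_right, Adjointable.inner_star_right]
  exact Finset.sum_comm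

theorem amplify_eq_ofMatrix (T : Adjointable Aᵐᵒᵖ (L2 Γ A)) (ζ : L2n Γ A n) :
    amplify T ζ = ofMatrix (fun i j => if i = j then T else 0) ζ := by
  refine WithCStarModule.ext fun i => ?_
  rw [ofMatrix_apply, Finset.sum_eq_single i]
  · simp [amplify]
  · intro j _ hj
    rw [if_neg (Ne.symm hj)]
    rfl
  · simp

/-! ### Finitely supported vectors -/

theorem L2.exists_finite_support_near (f : L2 I A) {ε : ℝ} (hε : 0 < ε) :
    ∃ h : L2 I A, {i | h i ≠ 0}.Finite ∧ ‖f - h‖ ≤ ε := by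
  classical
  obtain ⟨S, hS⟩ := summable_iff_vanishing_norm.1 f.summable_self (ε ^ 2) (by positivity)
  have hfin : {i | (if i ∈ S then f i else 0) ≠ 0}.Finite :=
    S.finite_toSet.subset fun i hi => by
      by_contra h
      exact hi (if_neg h)
  refine ⟨L2.ofFinite _ hfin, hfin, L2.norm_le_of_sum_le _ hε.le fun t => ?_⟩
  refine le_of_eq_of_le (congrArg norm ?_) (hS (t \ S) Finset.sdiff_disjoint).le
  rw [← Finset.sum_sdiff (Finset.inter_subset_left (s₁ := t) (s₂ := S))]
  rw [Finset.sdiff_inter_self_left, Finset.sum_eq_zero (s := t ∩ S), add_zero]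
  · refine Finset.sum_congr rfl fun i hi => ?_
    simp [(Finset.mem_sdiff.1 hi).2]
  · intro i hi
    simp [(Finset.mem_inter.1 hi).2]

theorem L2n.norm_sq (ζ : L2n Γ A n) :
    ‖ζ‖ ^ 2 = ‖∑ i, ∑' s, star (ζ i s) * ζ i s‖ := by
  rw [WithCStarModule.pi_norm_sq]
  simp only [L2.inner_def, ← Finset.op_sum, norm_op]

theorem L2n.norm_le_of_sum_le (ζ : L2n Γ A n) {C : ℝ} (hC : 0 ≤ C)
    (h : ∀ K : Finset Γ, ‖∑ t ∈ K, ∑ i, star (ζ i t) * ζ i t‖ ≤ C ^ 2) : ‖ζ‖ ≤ C := by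
  rw [← pow_le_pow_iff_left₀ (norm_nonneg _) hC two_ne_zero, L2n.norm_sq]
  have h1 : HasSum (fun t => ∑ i, star (ζ i t) * ζ i t) (∑ i, ∑' s, star (ζ i s) * ζ i s) :=
    hasSum_sum fun i _ => (ζ i).summable_self.hasSum
  exact le_of_tendsto h1.norm (Eventually.of_forall h)

theorem diracCore_dense (l : Γ → Matrix (Fin n) (Fin n) ℂ) :
    Dense ((diracCore A l).domain : Set (L2n Γ A n)) := by
  intro ζ
  rw [Metric.mem_closure_iff]
  intro ε hε
  choose h hfin hnear using fun i => (ζ i).exists_finite_support_near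
    (show 0 < ε / (n + 1) by positivity)
  let ξ : L2n Γ A n := (WithCStarModule.equiv Aᵐᵒᵖ (Fin n → L2 Γ A)).symm h
  refine ⟨ξ, hfin, ?_⟩
  rw [dist_eq_norm]
  calc ‖ζ - ξ‖ ≤ ∑ i, ‖(ζ - ξ) i‖ := WithCStarModule.pi_norm_le_sum_norm _
    _ ≤ ∑ _i : Fin n, ε / (n + 1) := Finset.sum_le_sum fun i _ => hnear i
    _ = n * (ε / (n + 1)) := by simp
    _ < ε := by
      rw [← mul_div_assoc, div_lt_iff₀ (by positivity)]
      nlinarith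

/-- An operator which is bounded by `C` on the finitely supported vectors has norm at most `C`. -/
theorem Adjointable.norm_le_of_core (l : Γ → Matrix (Fin n) (Fin n) ℂ)
    (d : Adjointable Aᵐᵒᵖ (L2n Γ A n)) {C : ℝ} (hC : 0 ≤ C)
    (h : ∀ ζ ∈ (diracCore A l).domain, ‖d ζ‖ ≤ C * ‖ζ‖) : ‖d‖ ≤ C := by
  refine ContinuousLinearMap.opNorm_le_bound _ hC fun ζ => ?_
  have hcl : IsClosed {ζ : L2n Γ A n | ‖d.toCLM ζ‖ ≤ C * ‖ζ‖} :=
    isClosed_le (by fun_prop) (by fun_prop)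
  exact hcl.closure_subset_iff.2 (fun ζ hζ => h ζ hζ) (diracCore_dense l ζ)

end Operators

/-! ### Commutators with the Dirac operator -/

section Commutator

variable {Γ A : Type*} [Group Γ] [CStarAlgebra A] [PartialOrder A] [StarOrderedRing A] {n : ℕ}
  {l : Γ → Matrix (Fin n) (Fin n) ℂ}

open scoped WithCStarModule

theorem diracCore_domain_le (ζ : L2n Γ A n) (hζ : ζ ∈ (diracCore A l).domain) :
    ζ ∈ (dirac A l).domain :=
  (LinearPMap.le_closure (diracCore A l)).1 hζ

theorem isDiracCommutator_unique {z : Adjointable Aᵐᵒᵖ (L2 Γ A)}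
    {d d' : Adjointable Aᵐᵒᵖ (L2n Γ A n)} (h : IsDiracCommutator l z d)
    (h' : IsDiracCommutator l z d') : d = d' := by
  have h1 : Set.EqOn d.toCLM d'.toCLM (diracCore A l).domain := by
    intro ζ hζ
    obtain ⟨_, h2⟩ := h ⟨ζ, diracCore_domain_le ζ hζ⟩
    obtain ⟨_, h3⟩ := h' ⟨ζ, diracCore_domain_le ζ hζ⟩
    exact h2.trans h3.symm
  have h4 :=
    Continuous.ext_on (diracCore_dense (A := A) l) d.toCLM.continuous d'.toCLM.continuous h1
  exact Adjointable.ext fun ζ => congrFun h4 ζ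

theorem diracSeminorm_eq_norm {z : Adjointable Aᵐᵒᵖ (L2 Γ A)}
    {d : Adjointable Aᵐᵒᵖ (L2n Γ A n)} (h : IsDiracCommutator l z d) : diracSeminorm l z = ‖d‖ := by
  have hex : ∃ d, IsDiracCommutator l z d := ⟨d, h⟩
  rw [diracSeminorm, dif_pos hex, isDiracCommutator_unique hex.choose_spec h]

/-- It suffices to compute a commutator with `D_l` on the finitely supported vectors, which form a
core. -/
theorem isDiracCommutator_of_core {z : Adjointable Aᵐᵒᵖ (L2 Γ A)}
    {d : Adjointable Aᵐᵒᵖ (L2n Γ A n)}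
    (h : ∀ ζ : (diracCore A l).domain, ∃ h : amplify z ζ.1 ∈ (diracCore A l).domain,
      d ζ.1 = diracCore A l ⟨amplify z ζ.1, h⟩ - amplify z (diracCore A l ζ)) :
    IsDiracCommutator l z d := by
  by_cases hcl : (diracCore A l).IsClosable
  · intro ζ
    have hgraph : ∀ p ∈ (diracCore A l).graph.topologicalClosure,
        (amplify z p.1, d p.1 + amplify z p.2) ∈ (diracCore A l).graph.topologicalClosure := by
      have hcont : Continuous fun p : L2n Γ A n × L2n Γ A n =>
          (amplify z p.1, d p.1 + amplify z p.2) := by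
        simp only [amplify_eq_ofMatrix]
        exact ((ofMatrix fun i j => if i = j then z else 0).toCLM.continuous.comp
          continuous_fst).prodMk ((d.toCLM.continuous.comp continuous_fst).add
            ((ofMatrix fun i j => if i = j then z else 0).toCLM.continuous.comp continuous_snd))
      intro p hp
      refine map_mem_closure (s := ((diracCore A l).graph : Set (L2n Γ A n × L2n Γ A n)))
        (t := ((diracCore A l).graph : Set (L2n Γ A n × L2n Γ A n)))
        (f := fun p => (amplify z p.1, d p.1 + amplify z p.2)) hcont hp ?_
      rintro ⟨q₁, q₂⟩ hq
      obtain ⟨ζ, hζ1, hζ2⟩ := (LinearPMap.mem_graph_iff _).1 hq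
      obtain rfl : ζ.1 = q₁ := hζ1
      obtain rfl : diracCore A l ζ = q₂ := hζ2
      obtain ⟨h1, h2⟩ := h ζ
      refine (LinearPMap.mem_graph_iff _).2 ⟨⟨_, h1⟩, rfl, ?_⟩
      change _ = d ζ.1 + amplify z (diracCore A l ζ)
      rw [h2, sub_add_cancel]
    rw [hcl.graph_closure_eq_closure_graph] at hgraph
    obtain ⟨ξ, hξ1, hξ2⟩ := (LinearPMap.mem_graph_iff _).1
      (hgraph _ (LinearPMap.mem_graph (diracCore A l).closure ζ))
    simp only at hξ1 hξ2
    refine ⟨hξ1 ▸ ξ.2, ?_⟩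
    rw [eq_sub_iff_add_eq]
    refine hξ2.symm.trans ?_
    congr 1
    exact Subtype.ext hξ1
  · -- `LinearPMap.closure` returns the operator itself if it is not closable, so that there is
    -- nothing to prove and closability need not be established here
    rw [IsDiracCommutator, dirac, LinearPMap.closure_def' hcl]
    exact h

theorem IsDiracCommutator.add {z z' : Adjointable Aᵐᵒᵖ (L2 Γ A)}
    {d d' : Adjointable Aᵐᵒᵖ (L2n Γ A n)} (h : IsDiracCommutator l z d)
    (h' : IsDiracCommutator l z' d') : IsDiracCommutator l (z + z') (d + d') := by
  intro ζ
  obtain ⟨h1, h2⟩ := h ζ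
  obtain ⟨h3, h4⟩ := h' ζ
  refine ⟨(dirac A l).domain.add_mem h1 h3, ?_⟩
  have h6 := (dirac A l).map_add ⟨_, h1⟩ ⟨_, h3⟩
  rw [Adjointable.add_apply, h2, h4]
  refine Eq.trans ?_ (congrArg (· - (amplify z (dirac A l ζ) + amplify z' (dirac A l ζ))) h6.symm)
  abel

theorem IsDiracCommutator.smul {z : Adjointable Aᵐᵒᵖ (L2 Γ A)}
    {d : Adjointable Aᵐᵒᵖ (L2n Γ A n)} (h : IsDiracCommutator l z d) (c : ℂ) :
    IsDiracCommutator l (c • z) (c • d) := by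
  intro ζ
  obtain ⟨h1, h2⟩ := h ζ
  refine ⟨(dirac A l).domain.smul_mem c h1, ?_⟩
  have h6 := (dirac A l).map_smul c ⟨_, h1⟩
  rw [Adjointable.smul_apply, h2, smul_sub]
  exact congrArg (· - c • amplify z (dirac A l ζ)) h6.symm

theorem isDiracCommutator_zero : IsDiracCommutator l (0 : Adjointable Aᵐᵒᵖ (L2 Γ A)) 0 := by
  intro ζ
  refine ⟨(dirac A l).domain.zero_mem, ?_⟩
  have h6 := (dirac A l).map_zero
  exact (sub_zero (0 : L2n Γ A n)).symm.trans (congrArg (· - (0 : L2n Γ A n)) h6.symm)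

theorem IsDiracCommutator.sum {ι : Type*} (S : Finset ι) {z : ι → Adjointable Aᵐᵒᵖ (L2 Γ A)}
    {d : ι → Adjointable Aᵐᵒᵖ (L2n Γ A n)} (h : ∀ i ∈ S, IsDiracCommutator l (z i) (d i)) :
    IsDiracCommutator l (∑ i ∈ S, z i) (∑ i ∈ S, d i) := by
  classical
  induction S using Finset.induction_on with
  | empty => exact isDiracCommutator_zero
  | insert i S hi ih =>
    rw [Finset.sum_insert hi, Finset.sum_insert hi]
    exact (h i (Finset.mem_insert_self i S)).add
      (ih fun j hj => h j (Finset.mem_insert_of_mem hj))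

variable (α : Γ →* (A ≃⋆ₐ[ℂ] A)) (hl : IsMatrixLength l)

/-- The commutator `[D_l, π_α(x) λ_g]`, whose matrix entries are `π_α(x) λ_g` followed by the
multiplication by the bounded functions `t ↦ (l(t) - l(g⁻¹ t))ᵢⱼ`. -/
def commOp (x : A) (g : Γ) : Adjointable Aᵐᵒᵖ (L2n Γ A n) :=
  ofMatrix fun i j => mulOp (m := fun t => (l t - l (g⁻¹ * t)) i j)
    (fun t => (hl.bounded g).choose_spec t i j) * crossedGen α x g

theorem commOp_apply (x : A) (g : Γ) (ζ : L2n Γ A n) (i : Fin n) (t : Γ) :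
    commOp α hl x g ζ i t = ∑ j, (l t - l (g⁻¹ * t)) i j • (α t⁻¹ x * ζ j (g⁻¹ * t)) := by
  rw [commOp, ofMatrix_apply, L2.sum_apply]
  rfl

theorem isDiracCommutator_commOp (x : A) (g : Γ) :
    IsDiracCommutator l (crossedGen α x g) (commOp α hl x g) := by
  refine isDiracCommutator_of_core fun ζ => ?_
  have hmem : amplify (crossedGen α x g) ζ.1 ∈ (diracCore A l).domain := fun i => by
    refine ((ζ.2 i).image (g * ·)).subset fun t ht => ⟨g⁻¹ * t, fun h => ht ?_, by simp⟩
    change α t⁻¹ x * ζ.1 i (g⁻¹ * t) = 0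
    rw [h, mul_zero]
  refine ⟨hmem, WithCStarModule.ext fun i => L2.ext fun t => ?_⟩
  rw [commOp_apply]
  change _ = (∑ j, l t i j • (α t⁻¹ x * ζ.1 j (g⁻¹ * t)))
    - α t⁻¹ x * ∑ j, l (g⁻¹ * t) i j • ζ.1 j (g⁻¹ * t)
  rw [Finset.mul_sum, ← Finset.sum_sub_distrib]
  refine Finset.sum_congr rfl fun j _ => ?_
  rw [mul_smul_comm, ← sub_smul, Matrix.sub_apply]

theorem star_commOp (x : A) (g : Γ) :
    star (commOp α hl x g) = -commOp α hl (α g⁻¹ (star x)) g⁻¹ := by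
  refine Adjointable.ext fun ζ => WithCStarModule.ext fun i => L2.ext fun t => ?_
  have hneg : (-commOp α hl (α g⁻¹ (star x)) g⁻¹) ζ i t
      = -(commOp α hl (α g⁻¹ (star x)) g⁻¹ ζ i t) := rfl
  rw [hneg, commOp_apply, commOp, star_ofMatrix, ofMatrix_apply, L2.sum_apply,
    ← Finset.sum_neg_distrib]
  refine Finset.sum_congr rfl fun j _ => ?_
  rw [star_mul, star_mulOp, star_crossedGen, Adjointable.mul_apply, crossedGen_apply, mulOp_apply,
    mul_smul_comm, ← neg_smul, inv_inv, inv_mul_cancel_left]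
  congr 1
  have h1 := (hl.isSelfAdjoint (g * t)).apply i j
  have h2 := (hl.isSelfAdjoint t).apply i j
  rw [Matrix.sub_apply, Matrix.sub_apply, star_sub, h1, h2, neg_sub]

end Commutator

/-! ### Order estimates in Hilbert modules -/

section Order

theorem Adjointable.inner_apply_le {B E : Type*} [CStarAlgebra B] [PartialOrder B]
    [StarOrderedRing B] [NormedAddCommGroup E] [NormedSpace ℂ E] [SMul B E] [CStarModule B E]
    [CompleteSpace E] (T : Adjointable B E) (x : E) :
    inner B (T x) (T x) ≤ ((‖T‖ ^ 2 : ℝ) : ℂ) • inner B x x := by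
  let := CStarAlgebra.spectralOrder (Adjointable B E)
  have := CStarAlgebra.spectralOrderedRing (Adjointable B E)
  have h : star T * T ≤ algebraMap ℝ (Adjointable B E) (‖T‖ ^ 2) :=
    CStarAlgebra.star_mul_le_algebraMap_norm_sq
  obtain ⟨b, hb⟩ := CStarAlgebra.nonneg_iff_eq_star_mul_self.1 (sub_nonneg.2 h)
  rw [← sub_nonneg]
  have h1 : ((‖T‖ ^ 2 : ℝ) : ℂ) • inner B x x - inner B (T x) (T x) = inner B (b x) (b x) := by
    rw [← Adjointable.inner_star_right, ← Adjointable.inner_star_right, ← Adjointable.mul_apply,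
      ← Adjointable.mul_apply, ← hb, Algebra.algebraMap_eq_smul_one, ← Complex.coe_smul,
      ← CStarModule.inner_smul_right_complex, ← CStarModule.inner_sub_right]
    rfl
  rw [h1]
  exact CStarModule.inner_self_nonneg

/-- The Cauchy–Schwarz inequality for finite linear combinations in a `C*`-algebra. -/
theorem star_sum_smul_mul_le {ι A : Type*} [CStarAlgebra A] [PartialOrder A] [StarOrderedRing A]
    (s : Finset ι) (c : ι → ℂ) (y : ι → A) :
    star (∑ k ∈ s, c k • y k) * (∑ k ∈ s, c k • y k) ≤
      ((∑ k ∈ s, ‖c k‖ ^ 2 : ℝ) : ℂ) • ∑ k ∈ s, star (y k) * y k := by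
  let x : L2 s A := L2.ofFinite (fun k => star (c k) • (1 : A)) (Set.toFinite _)
  let z : L2 s A := L2.ofFinite (fun k => y k) (Set.toFinite _)
  have hxz : (inner Aᵐᵒᵖ x z).unop = ∑ k ∈ s, c k • y k := by
    rw [L2.inner_def, unop_op, tsum_fintype, ← Finset.sum_coe_sort s]
    simp [x, z]
  have hzx : (inner Aᵐᵒᵖ z x).unop = star (∑ k ∈ s, c k • y k) := by
    rw [← hxz, ← unop_star, CStarModule.star_inner]
  have hzz : (inner Aᵐᵒᵖ z z).unop = ∑ k ∈ s, star (y k) * y k := by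
    rw [L2.inner_def, unop_op, tsum_fintype, ← Finset.sum_coe_sort s]
    simp [z]
  have hx : ‖x‖ ^ 2 ≤ ∑ k ∈ s, ‖c k‖ ^ 2 := by
    rw [L2.norm_sq, tsum_fintype, ← Finset.sum_coe_sort s]
    refine (norm_sum_le _ _).trans (Finset.sum_le_sum fun k _ => ?_)
    rw [CStarRing.norm_star_mul_self, ← pow_two]
    refine pow_le_pow_left₀ (norm_nonneg _) ?_ 2
    change ‖star (c k) • (1 : A)‖ ≤ _
    rw [norm_smul, norm_star]
    refine mul_le_of_le_one_right (norm_nonneg _) ?_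
    rcases subsingleton_or_nontrivial A with hA | hA
    · rw [Subsingleton.elim (1 : A) 0, norm_zero]
      exact zero_le_one
    · exact CStarRing.norm_one.le
  have h := unop_le_unop.2 (CStarModule.inner_mul_inner_swap_le (A := Aᵐᵒᵖ) (x := x) (y := z))
  rw [unop_mul, unop_smul, hxz, hzx, hzz, ← Complex.coe_smul] at h
  exact h.trans (ofReal_smul_le_smul (Finset.sum_nonneg fun k _ => star_mul_self_nonneg _) hx)

end Order

/-! ### Slicing the commutators -/

section Slice

variable {Γ A : Type*} [Group Γ] [CStarAlgebra A] [PartialOrder A] [StarOrderedRing A] {n : ℕ}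
  {l : Γ → Matrix (Fin n) (Fin n) ℂ} (α : Γ →* (A ≃⋆ₐ[ℂ] A)) (hl : IsMatrixLength l)

open scoped WithCStarModule

theorem Adjointable.sum_apply {B E ι : Type*} [CStarAlgebra B] [PartialOrder B]
    [StarOrderedRing B] [NormedAddCommGroup E] [NormedSpace ℂ E] [SMul B E] [CStarModule B E]
    (s : Finset ι) (T : ι → Adjointable B E) (x : E) : (∑ i ∈ s, T i) x = ∑ i ∈ s, T i x := by
  classical
  induction s using Finset.induction_on with
  | empty => rfl
  | insert i s hi ih => rw [Finset.sum_insert hi, Finset.sum_insert hi, Adjointable.add_apply, ih]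

theorem L2n.sum_apply {ι : Type*} (s : Finset ι) (f : ι → L2n Γ A n) (i : Fin n) (t : Γ) :
    (∑ j ∈ s, f j : L2n Γ A n) i t = ∑ j ∈ s, f j i t := by
  classical
  induction s using Finset.induction_on with
  | empty => rfl
  | insert j s hj ih =>
    rw [Finset.sum_insert hj, Finset.sum_insert hj, WithCStarModule.add_apply, L2.add_apply, ih]

theorem sum_commOp_apply (S : Finset Γ) (x : Γ → A) (ζ : L2n Γ A n) (i : Fin n) (t : Γ) :
    (∑ g ∈ S, commOp α hl (x g) g) ζ i t
      = ∑ g ∈ S, ∑ j, (l t - l (g⁻¹ * t)) i j • (α t⁻¹ (x g) * ζ j (g⁻¹ * t)) := by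
  rw [Adjointable.sum_apply, L2n.sum_apply]
  exact Finset.sum_congr rfl fun g _ => commOp_apply α hl (x g) g ζ i t

/-- The operator obtained from `∑ x_g λ_g` by replacing each `x_g` by its multiple with the matrix
entry of `[D_l, λ_g]` which contributes to the coordinate `(t, i)` of `[D_l, λ_g] ζ`. -/
def sliceOp (l : Γ → Matrix (Fin n) (Fin n) ℂ) (S : Finset Γ) (x : Γ → A) (ζ : L2n Γ ℂ n) (t : Γ)
    (i : Fin n) : Adjointable Aᵐᵒᵖ (L2 Γ A) :=
  ∑ g ∈ S, ∑ j, ((l t - l (g⁻¹ * t)) i j * ζ j (g⁻¹ * t)) • crossedGen α (x g) g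

/-- The vector `s ↦ α_p⁻¹(v(s p⁻¹)) ⊗ ζ(s)`. -/
def twist (v : L2 Γ A) {ζ : L2n Γ ℂ n} (hζ : ∀ i, {s | ζ i s ≠ 0}.Finite) (p : Γ) : L2n Γ A n :=
  (WithCStarModule.equiv Aᵐᵒᵖ (Fin n → L2 Γ A)).symm fun j =>
    L2.ofFinite (fun s => ζ j s • α p⁻¹ (v (s * p⁻¹)))
      ((hζ j).subset fun s hs h => hs (by rw [h, zero_smul]))

theorem twist_apply (v : L2 Γ A) {ζ : L2n Γ ℂ n} (hζ : ∀ i, {s | ζ i s ≠ 0}.Finite) (p : Γ)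
    (j : Fin n) (s : Γ) : twist α v hζ p j s = ζ j s • α p⁻¹ (v (s * p⁻¹)) := rfl

/-- The absorption identity: on the diagonal `t = r p` the slices of `∑ x_g λ_g` are given by the
commutator `[D_l, ∑ x_g λ_g]` itself, up to a twist by the automorphism `α_p`. -/
theorem sliceOp_apply (S : Finset Γ) (x : Γ → A) (v : L2 Γ A) {ζ : L2n Γ ℂ n}
    (hζ : ∀ i, {s | ζ i s ≠ 0}.Finite) (r t : Γ) (i : Fin n) :
    sliceOp α l S x ζ t i v r
      = α (r⁻¹ * t) ((∑ g ∈ S, commOp α hl (x g) g) (twist α v hζ (r⁻¹ * t)) i t) := by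
  rw [sum_commOp_apply, sliceOp, Adjointable.sum_apply, L2.sum_apply, map_sum]
  refine Finset.sum_congr rfl fun g _ => ?_
  rw [Adjointable.sum_apply, L2.sum_apply, map_sum]
  refine Finset.sum_congr rfl fun j _ => ?_
  have h1 : ∀ a : A, α (r⁻¹ * t) (α t⁻¹ a) = α r⁻¹ a := fun a => by
    rw [← StarAlgEquiv.mul_apply, ← map_mul]
    simp
  have h2 : ∀ a : A, α (r⁻¹ * t) (α (r⁻¹ * t)⁻¹ a) = a := fun a => by
    rw [← StarAlgEquiv.mul_apply, ← map_mul]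
    simp
  rw [twist_apply, map_smul, map_mul, map_smul, h1, h2, mul_smul_comm, smul_smul]
  simp only [Adjointable.smul_apply, L2.smul_apply, crossedGen_apply, mul_inv_rev, inv_inv,
    mul_assoc, mul_inv_cancel_left]

theorem sum_sum_norm_sq_eq {ζ : L2n Γ ℂ n} (Z : Finset Γ) (hZ : ∀ i s, ζ i s ≠ 0 → s ∈ Z) :
    ∑ j, ∑ s ∈ Z, ‖ζ j s‖ ^ 2 = ‖ζ‖ ^ 2 := by
  have h : ∑ j, ∑' s, star (ζ j s) * ζ j s = ((∑ j, ∑ s ∈ Z, ‖ζ j s‖ ^ 2 : ℝ) : ℂ) := by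
    push_cast
    refine Finset.sum_congr rfl fun j _ => ?_
    rw [tsum_eq_sum (s := Z) fun s hs => by
      rw [not_imp_comm.1 (hZ j s) hs, mul_zero]]
    refine Finset.sum_congr rfl fun s _ => ?_
    rw [RCLike.star_def, Complex.conj_mul']
  rw [L2n.norm_sq, h, Complex.norm_real, Real.norm_of_nonneg]
  exact Finset.sum_nonneg fun j _ => Finset.sum_nonneg fun s _ => by positivity

theorem L2n.sum_apply_le (d : Adjointable Aᵐᵒᵖ (L2n Γ A n)) (V : L2n Γ A n) (K : Finset Γ) :
    ∑ t ∈ K, ∑ i, star (d V i t) * d V i t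
      ≤ ((‖d‖ ^ 2 : ℝ) : ℂ) • ∑ i, ∑' s, star (V i s) * V i s := by
  have h1 : ∑ t ∈ K, ∑ i, star (d V i t) * d V i t ≤ ∑ i, ∑' s, star (d V i s) * d V i s := by
    rw [Finset.sum_comm]
    exact Finset.sum_le_sum fun i _ => (d V i).summable_self.sum_le_tsum K
      fun t _ => star_mul_self_nonneg _
  have h2 := unop_le_unop.2 (Adjointable.inner_apply_le d V)
  simp only [WithCStarModule.pi_inner, L2.inner_def, ← Finset.op_sum, unop_smul, unop_op] at h2
  exact h1.trans h2

theorem sum_twist (v : L2 Γ A) {ζ : L2n Γ ℂ n} (hζ : ∀ i, {s | ζ i s ≠ 0}.Finite) (p : Γ)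
    (Z : Finset Γ) (hZ : ∀ i s, ζ i s ≠ 0 → s ∈ Z) :
    α p (∑ i, ∑' s, star (twist α v hζ p i s) * twist α v hζ p i s)
      = ∑ i, ∑ s ∈ Z, ((‖ζ i s‖ ^ 2 : ℝ) : ℂ) • (star (v (s * p⁻¹)) * v (s * p⁻¹)) := by
  rw [map_sum]
  refine Finset.sum_congr rfl fun i _ => ?_
  rw [tsum_eq_sum (s := Z) fun s hs => by
    rw [twist_apply, not_imp_comm.1 (hZ i s) hs, zero_smul, mul_zero], map_sum]
  refine Finset.sum_congr rfl fun s _ => ?_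
  have h2 : ∀ a : A, α p (α p⁻¹ a) = a := fun a => by
    rw [← StarAlgEquiv.mul_apply, ← map_mul]
    simp
  rw [twist_apply, star_smul_mul_smul, map_smul, map_mul, map_star, h2]

/-- The column of all slices of `∑ x_g λ_g` by a finitely supported vector `ζ` is bounded by
`‖[D_l, ∑ x_g λ_g]‖ ‖ζ‖`. -/
theorem norm_sum_sliceOp_le (S : Finset Γ) (x : Γ → A) {ζ : L2n Γ ℂ n}
    (hζ : ∀ i, {s | ζ i s ≠ 0}.Finite) (K : Finset Γ) (ω : Γ → Fin n → ℂ) :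
    ‖∑ t ∈ K, ∑ i, ω t i • sliceOp α l S x ζ t i‖
      ≤ √(∑ t ∈ K, ∑ i, ‖ω t i‖ ^ 2) * (‖∑ g ∈ S, commOp α hl (x g) g‖ * ‖ζ‖) := by
  classical
  set d := ∑ g ∈ S, commOp α hl (x g) g with hd
  set W := ∑ t ∈ K, ∑ i, ‖ω t i‖ ^ 2 with hW
  have hW0 : 0 ≤ W := Finset.sum_nonneg fun t _ => Finset.sum_nonneg fun i _ => by positivity
  obtain ⟨Z, hZ⟩ : ∃ Z : Finset Γ, ∀ i s, ζ i s ≠ 0 → s ∈ Z :=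
    ⟨(Set.finite_iUnion hζ).toFinset, fun i s h => by simpa using ⟨i, h⟩⟩
  refine ContinuousLinearMap.opNorm_le_bound _ (by positivity) fun v => ?_
  refine L2.norm_le_of_sum_le _ (by positivity) fun R => ?_
  let T : Γ → Fin n → L2 Γ A := fun t i => sliceOp α l S x ζ t i v
  have hv : ∀ r, ((∑ t ∈ K, ∑ i, ω t i • sliceOp α l S x ζ t i) v) r
      = ∑ k ∈ K ×ˢ Finset.univ, ω k.1 k.2 • T k.1 k.2 r := by
    intro r
    rw [Adjointable.sum_apply, L2.sum_apply, Finset.sum_product]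
    refine Finset.sum_congr rfl fun t _ => ?_
    rw [Adjointable.sum_apply, L2.sum_apply]
    rfl
  -- the twisted commutators appear on the diagonals `p = r⁻¹ t`
  let Q : Γ → Γ → A := fun p t =>
    α p (∑ i, star (d (twist α v hζ p) i t) * d (twist α v hζ p) i t)
  have hQ0 : ∀ p t, 0 ≤ Q p t := fun p t =>
    map_nonneg (α p) (Finset.sum_nonneg fun i _ => star_mul_self_nonneg _)
  have hTQ : ∀ r t, ∑ i, star (T t i r) * T t i r = Q (r⁻¹ * t) t := by
    intro r t
    simp only [Q]
    rw [map_sum]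
    refine Finset.sum_congr rfl fun i _ => ?_
    rw [sliceOp_apply α hl S x v hζ, ← hd, map_mul (α (r⁻¹ * t)) (star _), map_star (α (r⁻¹ * t))]
  let P : Finset Γ := (R ×ˢ K).image fun q => q.1⁻¹ * q.2
  have hRP : ∀ t ∈ K, ∑ r ∈ R, Q (r⁻¹ * t) t ≤ ∑ p ∈ P, Q p t := by
    intro t ht
    rw [← Finset.sum_image (s := R) (g := fun r => r⁻¹ * t) (f := fun p => Q p t)
      (fun a _ b _ hab => by simpa using hab)]
    refine Finset.sum_le_sum_of_subset_of_nonneg (fun p hp => ?_) fun p _ _ => hQ0 p t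
    obtain ⟨r, hr, rfl⟩ := Finset.mem_image.1 hp
    exact Finset.mem_image.2 ⟨(r, t), Finset.mem_product.2 ⟨hr, ht⟩, rfl⟩
  let M : Γ → A := fun s => ∑ p ∈ P, star (v (s * p⁻¹)) * v (s * p⁻¹)
  have hM : ∀ s, ‖M s‖ ≤ ‖v‖ ^ 2 := by
    intro s
    have h1 : M s = ∑ r ∈ P.image (s * ·⁻¹), star (v r) * v r := by
      rw [Finset.sum_image fun a _ b _ hab => by simpa using hab]
    rw [h1]
    exact L2.norm_sum_le v _
  have hmain : ∑ r ∈ R, star (((∑ t ∈ K, ∑ i, ω t i • sliceOp α l S x ζ t i) v) r) *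
      ((∑ t ∈ K, ∑ i, ω t i • sliceOp α l S x ζ t i) v) r
      ≤ (W : ℂ) • ((‖d‖ ^ 2 : ℝ) : ℂ) • ∑ i, ∑ s ∈ Z, ((‖ζ i s‖ ^ 2 : ℝ) : ℂ) • M s := by
    calc _ ≤ ∑ r ∈ R, (W : ℂ) • ∑ t ∈ K, Q (r⁻¹ * t) t := by
          refine Finset.sum_le_sum fun r _ => ?_
          rw [hv]
          refine (star_sum_smul_mul_le _ _ _).trans_eq ?_
          rw [Finset.sum_product, Finset.sum_product]
          simp only [hTQ, hW]
      _ = (W : ℂ) • ∑ t ∈ K, ∑ r ∈ R, Q (r⁻¹ * t) t := by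
          rw [← Finset.smul_sum, Finset.sum_comm]
      _ ≤ (W : ℂ) • ∑ p ∈ P, ((‖d‖ ^ 2 : ℝ) : ℂ) •
            ∑ i, ∑ s ∈ Z, ((‖ζ i s‖ ^ 2 : ℝ) : ℂ) • (star (v (s * p⁻¹)) * v (s * p⁻¹)) := by
          refine smul_le_smul_of_nonneg_left ?_ (Complex.zero_le_real.2 hW0)
          refine (Finset.sum_le_sum hRP).trans ?_
          rw [Finset.sum_comm]
          refine Finset.sum_le_sum fun p _ => ?_
          rw [← sum_twist α v hζ p Z hZ, ← map_smul, ← map_sum]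
          exact OrderHomClass.mono (α p) (L2n.sum_apply_le d _ K)
      _ = _ := by
          rw [← Finset.smul_sum, Finset.sum_comm]
          congr 2
          refine Finset.sum_congr rfl fun i _ => ?_
          rw [Finset.sum_comm]
          simp only [M, Finset.smul_sum]
  refine (CStarAlgebra.norm_le_norm_of_nonneg_of_le
    (Finset.sum_nonneg fun i _ => star_mul_self_nonneg _) hmain).trans ?_
  rw [norm_smul, norm_smul, Complex.norm_real, Complex.norm_real, Real.norm_of_nonneg hW0,
    Real.norm_of_nonneg (by positivity)]
  have hlast : ‖∑ i, ∑ s ∈ Z, ((‖ζ i s‖ ^ 2 : ℝ) : ℂ) • M s‖ ≤ ‖ζ‖ ^ 2 * ‖v‖ ^ 2 := by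
    rw [← sum_sum_norm_sq_eq Z hZ, Finset.sum_mul]
    refine (norm_sum_le _ _).trans (Finset.sum_le_sum fun i _ => ?_)
    rw [Finset.sum_mul]
    refine (norm_sum_le _ _).trans (Finset.sum_le_sum fun s _ => ?_)
    rw [norm_smul, Complex.norm_real, Real.norm_of_nonneg (by positivity)]
    exact mul_le_mul_of_nonneg_left (hM s) (by positivity)
  calc W * (‖d‖ ^ 2 * ‖∑ i, ∑ s ∈ Z, ((‖ζ i s‖ ^ 2 : ℝ) : ℂ) • M s‖)
      ≤ W * (‖d‖ ^ 2 * (‖ζ‖ ^ 2 * ‖v‖ ^ 2)) := by gcongr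
    _ = (√W * (‖d‖ * ‖ζ‖) * ‖v‖) ^ 2 := by
      rw [mul_pow, mul_pow, Real.sq_sqrt hW0]
      ring

/-- Applying a functional `η` of norm at most one to the terms of `∑ x_g λ_g` gives the element
`∑ η(x_g λ_g) λ_g` of the group algebra, and this does not increase the norm of the commutator with
the Dirac operator. -/
theorem norm_sum_commOp_slice_le (S : Finset Γ) (x : Γ → A)
    (η : Adjointable Aᵐᵒᵖ (L2 Γ A) →L[ℂ] ℂ) (hη : ‖η‖ ≤ 1) :
    ‖∑ g ∈ S, commOp (trivialAction Γ) hl (η (crossedGen α (x g) g)) g‖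
      ≤ ‖∑ g ∈ S, commOp α hl (x g) g‖ := by
  refine Adjointable.norm_le_of_core l _ (norm_nonneg _) fun ζ hζ => ?_
  refine L2n.norm_le_of_sum_le _ (by positivity) fun K => ?_
  have ha : ∀ t i, (∑ g ∈ S, commOp (trivialAction Γ) hl (η (crossedGen α (x g) g)) g) ζ i t
      = η (sliceOp α l S x ζ t i) := by
    intro t i
    rw [sum_commOp_apply, sliceOp, map_sum]
    refine Finset.sum_congr rfl fun g _ => ?_
    rw [map_sum]
    refine Finset.sum_congr rfl fun j _ => ?_
    rw [map_smul, smul_eq_mul, smul_eq_mul]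
    change _ * (η (crossedGen α (x g) g) * _) = _
    ring
  simp only [ha]
  set a : Γ → Fin n → ℂ := fun t i => η (sliceOp α l S x ζ t i) with hadef
  set q : ℝ := ∑ t ∈ K, ∑ i, ‖a t i‖ ^ 2 with hq
  have hq0 : 0 ≤ q := Finset.sum_nonneg fun t _ => Finset.sum_nonneg fun i _ => by positivity
  have h1 : ∑ t ∈ K, ∑ i, star (a t i) * a t i = (q : ℂ) := by
    simp only [hq, Complex.ofReal_sum, Complex.ofReal_pow, RCLike.star_def, Complex.conj_mul']
  have h2 : ∑ t ∈ K, ∑ i, star (a t i) * a t i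
      = η (∑ t ∈ K, ∑ i, star (a t i) • sliceOp α l S x ζ t i) := by
    simp only [map_sum, map_smul, smul_eq_mul, hadef]
  have h3 := norm_sum_sliceOp_le α hl S x hζ K fun t i => star (a t i)
  simp only [norm_star] at h3
  rw [← hq] at h3
  have h4 : ‖(q : ℂ)‖ = q := by rw [Complex.norm_real, Real.norm_of_nonneg hq0]
  have h5 : q ≤ √q * (‖∑ g ∈ S, commOp α hl (x g) g‖ * ‖ζ‖) := by
    calc q = ‖η (∑ t ∈ K, ∑ i, star (a t i) • sliceOp α l S x ζ t i)‖ := by rw [← h2, h1, h4]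
      _ ≤ 1 * ‖∑ t ∈ K, ∑ i, star (a t i) • sliceOp α l S x ζ t i‖ :=
        η.le_of_opNorm_le hη _
      _ ≤ _ := by rwa [one_mul]
  change ‖∑ t ∈ K, ∑ i, star (a t i) * a t i‖ ≤ _
  rw [h1, h4]
  rcases hq0.eq_or_lt with h6 | h6
  · rw [← h6]
    positivity
  · have h7 : √q ≤ ‖∑ g ∈ S, commOp α hl (x g) g‖ * ‖ζ‖ := by
      refine le_of_mul_le_mul_left ?_ (Real.sqrt_pos.2 h6)
      rwa [Real.mul_self_sqrt hq0]
    calc q = √q ^ 2 := (Real.sq_sqrt hq0).symm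
      _ ≤ _ := pow_le_pow_left₀ (Real.sqrt_nonneg _) h7 2

end Slice

/-! ### Elements of the algebraic crossed product -/

section AlgCrossedProduct

variable {Γ A : Type*} [Group Γ] [CStarAlgebra A] [PartialOrder A] [StarOrderedRing A]
  (α : Γ →* (A ≃⋆ₐ[ℂ] A)) {X : OperatorSystem A} {hX : ∀ g, ∀ x ∈ X, α g x ∈ X}

/-- The linear map `x ↦ π_α(x) λ_g`. -/
def genLin (g : Γ) : A →ₗ[ℂ] ReducedCrossedProduct α where
  toFun x := gen α x g
  map_add' x y := by
    refine Subtype.ext (Adjointable.ext fun f => L2.ext fun t => ?_)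
    change α t⁻¹ (x + y) * f (g⁻¹ * t) = α t⁻¹ x * f (g⁻¹ * t) + α t⁻¹ y * f (g⁻¹ * t)
    rw [map_add, add_mul]
  map_smul' c x := by
    refine Subtype.ext (Adjointable.ext fun f => L2.ext fun t => ?_)
    change α t⁻¹ (c • x) * f (g⁻¹ * t) = c • (α t⁻¹ x * f (g⁻¹ * t))
    rw [map_smul, smul_mul_assoc]

@[simp] theorem genLin_apply (g : Γ) (x : A) : genLin α g x = gen α x g := rfl

theorem gen_one_one : gen α (1 : A) 1 = 1 := Subtype.ext (crossedGen_one_one α)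

theorem norm_gen_le (x : A) (g : Γ) : ‖gen α x g‖ ≤ ‖x‖ :=
  LinearMap.mkContinuous_norm_le _ (norm_nonneg x) (norm_crossedLin_le α x g)

theorem toOp_sum {ι : Type*} (S : Finset ι) (z : ι → ReducedCrossedProduct α) :
    (∑ i ∈ S, z i).toOp = ∑ i ∈ S, (z i).toOp := by
  classical
  induction S using Finset.induction_on with
  | empty => rfl
  | insert i S hi ih =>
    rw [Finset.sum_insert hi, Finset.sum_insert hi, ← ih]
    rfl

/-- The elements of the algebraic crossed product are the sums of their Fourier series. -/
theorem eq_sum_gen (z : algCrossedProduct α X hX) :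
    z.1 = ∑ g ∈ (finite_coeff α z).toFinset, gen α (coeff α g z.1) g := by
  classical
  let G : (Γ →₀ A) →ₗ[ℂ] ReducedCrossedProduct α := Finsupp.lsum ℂ fun g => genLin α g
  have hG : ∀ f g, coeff α g (G f) = f g := by
    intro f g
    induction f using Finsupp.induction_linear with
    | zero => rw [map_zero, coeff_zero, Finsupp.zero_apply]
    | add f h hf hh => rw [map_add, coeff_add, hf, hh, Finsupp.add_apply]
    | single s x =>
      rw [Finsupp.lsum_single, genLin_apply, coeff_gen, Finsupp.single_apply]
      simp only [eq_comm]
  have hle : (algCrossedProduct α X hX).toSubmodule ≤ LinearMap.range G := by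
    refine Submodule.span_le.2 ?_
    rintro _ ⟨x, -, g, rfl⟩
    exact ⟨Finsupp.single g x, by rw [Finsupp.lsum_single, genLin_apply]⟩
  obtain ⟨f, hf⟩ := hle z.2
  have hsupp : (finite_coeff α z).toFinset = f.support := by
    ext g
    rw [Set.Finite.mem_toFinset, Finsupp.mem_support_iff, Set.mem_ofPred_eq, ← hf, hG]
  rw [hsupp, ← hf]
  simp only [hG]
  exact Finsupp.lsum_apply ..

theorem toOp_eq_sum (z : algCrossedProduct α X hX) :
    z.1.toOp = ∑ g ∈ (finite_coeff α z).toFinset, crossedGen α (coeff α g z.1) g := by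
  conv_lhs => rw [eq_sum_gen α z, toOp_sum]
  rfl

variable {n : ℕ} {l : Γ → Matrix (Fin n) (Fin n) ℂ} (hl : IsMatrixLength l)

/-- The bounded extension of `[D_l, z]` for `z` in the algebraic crossed product. -/
def diracCommutator (z : algCrossedProduct α X hX) : Adjointable Aᵐᵒᵖ (L2n Γ A n) :=
  ∑ g ∈ (finite_coeff α z).toFinset, commOp α hl (coeff α g z.1) g

theorem isDiracCommutator_diracCommutator (z : algCrossedProduct α X hX) :
    IsDiracCommutator l z.1.toOp (diracCommutator α hl z) := by
  rw [toOp_eq_sum]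
  exact IsDiracCommutator.sum _ fun g _ => isDiracCommutator_commOp α hl _ g

theorem isDiracCommutator_star (z : algCrossedProduct α X hX) :
    IsDiracCommutator l (star z).1.toOp (-star (diracCommutator α hl z)) := by
  have h1 : (star z).1.toOp = star z.1.toOp := rfl
  rw [h1, toOp_eq_sum, diracCommutator, star_sum, star_sum, ← Finset.sum_neg_distrib]
  refine IsDiracCommutator.sum _ fun g _ => ?_
  rw [star_crossedGen, star_commOp α hl, neg_neg]
  exact isDiracCommutator_commOp α hl _ _

theorem diracSeminorm_eq (z : algCrossedProduct α X hX) :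
    diracSeminorm l z.1.toOp = ‖diracCommutator α hl z‖ :=
  diracSeminorm_eq_norm (isDiracCommutator_diracCommutator α hl z)

theorem isSlipNorm_diracSeminorm (hl : IsMatrixLength l) :
    IsSlipNorm fun z : algCrossedProduct α X hX => diracSeminorm l z.1.toOp where
  nonneg z := by
    rw [diracSeminorm_eq α hl]
    exact norm_nonneg _
  add_le z w := by
    have h := (isDiracCommutator_diracCommutator α hl z).add
      (isDiracCommutator_diracCommutator α hl w)
    rw [diracSeminorm_eq α hl z, diracSeminorm_eq α hl w]
    exact (diracSeminorm_eq_norm h).trans_le (norm_add_le _ _)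
  smul c z := by
    have h := (isDiracCommutator_diracCommutator α hl z).smul c
    rw [diracSeminorm_eq α hl z]
    exact (diracSeminorm_eq_norm h).trans (norm_smul _ _)
  scalar c := by
    have h0 : commOp α hl (1 : A) 1 = 0 := by
      refine Adjointable.ext fun ζ => WithCStarModule.ext fun i => L2.ext fun t => ?_
      rw [commOp_apply]
      simp only [inv_one, one_mul, sub_self, Matrix.zero_apply, zero_smul, Finset.sum_const_zero]
      rfl
    have h := (isDiracCommutator_commOp α hl 1 1).smul c
    rw [crossedGen_one_one, h0, smul_zero] at h
    exact (diracSeminorm_eq_norm h).trans norm_zero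
  star z := by
    rw [diracSeminorm_eq α hl z]
    refine (diracSeminorm_eq_norm (isDiracCommutator_star α hl z)).trans ?_
    rw [norm_neg, norm_star]

open scoped WithCStarModule in
/-- The coefficients of `z` are controlled by `[D_l, z]` outside the unit of the group, since
`[D_l, z]` sends `δ_e ⊗ e_j` to a vector with coordinates `l(g)ᵢⱼ α_g⁻¹(E_g(z))`. -/
theorem norm_coeff_mul_le [Nontrivial A] (hl : IsMatrixLength l) (z : algCrossedProduct α X hX)
    (g : Γ) (i j : Fin n) :
    ‖l g i j‖ * ‖coeff α g z.1‖ ≤ diracSeminorm l z.1.toOp := by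
  classical
  rw [diracSeminorm_eq α hl]
  by_cases hg : coeff α g z.1 = 0
  · rw [hg, norm_zero, mul_zero]
    exact norm_nonneg _
  let ζ : L2n Γ A n := (WithCStarModule.equiv Aᵐᵒᵖ (Fin n → L2 Γ A)).symm
    (Pi.single j (L2.single 1 1))
  have hζ : ‖ζ‖ ≤ 1 := by
    rw [WithCStarModule.norm_single]
    refine L2.norm_le_of_sum_le _ zero_le_one fun s => ?_
    have h1 : ∀ t ∈ s, t ≠ 1 →
        star ((L2.single 1 1 : L2 Γ A) t) * (L2.single 1 1 : L2 Γ A) t = 0 := by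
      intro t _ ht
      rw [L2.single_apply, Pi.single_eq_of_ne ht, mul_zero]
    by_cases h : (1 : Γ) ∈ s
    · rw [Finset.sum_eq_single_of_mem 1 h h1]
      simp
    · rw [Finset.sum_eq_zero fun t ht => h1 t ht fun h' => h (h' ▸ ht)]
      simp
  have hval : diracCommutator α hl z ζ i g = l g i j • α g⁻¹ (coeff α g z.1) := by
    rw [diracCommutator, sum_commOp_apply, Finset.sum_eq_single g, Finset.sum_eq_single j]
    · have h1 : ζ j (g⁻¹ * g) = 1 := by
        simp [ζ]
      rw [h1, inv_mul_cancel, (hl.eq_zero_iff 1).2 rfl, sub_zero, mul_one]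
    · intro k _ hk
      have h1 : ζ k (g⁻¹ * g) = 0 := by
        simp [ζ, Pi.single_eq_of_ne hk]
      rw [h1, mul_zero, smul_zero]
    · simp
    · intro h _ hh
      refine Finset.sum_eq_zero fun k _ => ?_
      have h1 : ζ k (h⁻¹ * g) = 0 := by
        have h2 : h⁻¹ * g ≠ 1 := fun h3 => hh (inv_mul_eq_one.1 h3)
        by_cases hk : k = j
        · subst hk
          simp [ζ, Pi.single_eq_of_ne h2]
        · simp [ζ, Pi.single_eq_of_ne hk]
      rw [h1, mul_zero, smul_zero]
    · intro h
      exact absurd ((finite_coeff α z).mem_toFinset.2 hg) h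
  calc ‖l g i j‖ * ‖coeff α g z.1‖ = ‖diracCommutator α hl z ζ i g‖ := by
        rw [hval, norm_smul, StarAlgEquiv.norm_map]
    _ ≤ ‖diracCommutator α hl z ζ i‖ := L2.norm_apply_le _ _
    _ ≤ ‖diracCommutator α hl z ζ‖ := WithCStarModule.norm_apply_le_norm _ _
    _ ≤ ‖diracCommutator α hl z‖ * ‖ζ‖ := Adjointable.norm_apply_le _ _
    _ ≤ _ := mul_le_of_le_one_right (norm_nonneg _) hζ

/-! ### The horizontal seminorm -/

section Horizontal

variable {LX : X → ℝ}

theorem IsSlipNorm.map_zero {B : Type*} [CStarAlgebra B] {Y : OperatorSystem B} {L : Y → ℝ}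
    (hL : IsSlipNorm L) : L 0 = 0 := by
  have h := hL.scalar 0
  rwa [zero_smul] at h

theorem coeffSeminorm_apply (hLX : IsSlipNorm LX) (z : algCrossedProduct α X hX) (g : Γ) :
    coeffSeminorm α LX z g = (LX ⟨coeff α g z.1, coeff_mem α g z⟩ : ℂ) := by
  classical
  rw [coeffSeminorm, Finsupp.finsetSum_apply]
  simp only [Finsupp.single_apply]
  rw [Finset.sum_ite_eq']
  split_ifs with h
  · rfl
  · have h1 : coeff α g z.1 = 0 := by simpa using h
    have h2 : (⟨coeff α g z.1, coeff_mem α g z⟩ : X) = 0 := Subtype.ext h1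
    rw [h2, hLX.map_zero, Complex.ofReal_zero]

variable (N : OrderPreservingNorm Γ)

theorem isSlipNorm_horizontalSeminorm (hLX : IsSlipNorm LX) :
    IsSlipNorm fun z : algCrossedProduct α X hX =>
      max (horizontalSeminorm α N LX z) (horizontalSeminorm α N LX (star z)) := by
  have hadd : ∀ z w : algCrossedProduct α X hX,
      horizontalSeminorm α N LX (z + w)
        ≤ horizontalSeminorm α N LX z + horizontalSeminorm α N LX w := by
    intro z w
    refine le_trans ?_ (map_add_le_add N.toSeminorm _ _)
    refine N.mono _ _ fun g => ?_
    rw [Finsupp.add_apply, coeffSeminorm_apply α hLX, coeffSeminorm_apply α hLX,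
      coeffSeminorm_apply α hLX, ← Complex.ofReal_add]
    refine ⟨Complex.zero_le_real.2 (hLX.nonneg _), Complex.real_le_real.2 ?_⟩
    refine le_of_eq_of_le (congrArg LX (Subtype.ext ?_)) (hLX.add_le _ _)
    exact coeff_add α g z.1 w.1
  have hsmul : ∀ (c : ℂ) (z : algCrossedProduct α X hX),
      horizontalSeminorm α N LX (c • z) = ‖c‖ * horizontalSeminorm α N LX z := by
    intro c z
    have h : coeffSeminorm α LX (c • z) = (‖c‖ : ℂ) • coeffSeminorm α LX z := by
      ext g
      rw [Finsupp.smul_apply, coeffSeminorm_apply α hLX, coeffSeminorm_apply α hLX, smul_eq_mul,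
        ← Complex.ofReal_mul, ← hLX.smul]
      congr 2
    rw [horizontalSeminorm, h, map_smul_eq_mul, Complex.norm_real, norm_norm]
    rfl
  have hone : horizontalSeminorm α N LX (1 : algCrossedProduct α X hX) = 0 := by
    have h : coeffSeminorm α LX (1 : algCrossedProduct α X hX) = 0 := by
      classical
      ext g
      rw [coeffSeminorm_apply α hLX, Finsupp.zero_apply, Complex.ofReal_eq_zero]
      have h1 : coeff α g (1 : algCrossedProduct α X hX).1 = if g = 1 then 1 else 0 := by
        rw [OperatorSystem.coe_one, ← gen_one_one α, coeff_gen]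
      by_cases hg : g = 1
      · have h2 : (⟨coeff α g (1 : algCrossedProduct α X hX).1, coeff_mem α g 1⟩ : X)
            = (1 : ℂ) • (1 : X) := by
          refine Subtype.ext ?_
          rw [one_smul]
          exact h1.trans (if_pos hg)
        rw [h2, hLX.scalar]
      · have h2 : (⟨coeff α g (1 : algCrossedProduct α X hX).1, coeff_mem α g 1⟩ : X) = 0 :=
          Subtype.ext (h1.trans (if_neg hg))
        rw [h2, hLX.map_zero]
    rw [horizontalSeminorm, h, map_zero]
  have hstar_add : ∀ z w : algCrossedProduct α X hX, star (z + w) = star z + star w :=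
    fun z w => Subtype.ext (star_add z.1 w.1)
  have hstar_smul : ∀ (c : ℂ) (z : algCrossedProduct α X hX), star (c • z) = star c • star z :=
    fun c z => Subtype.ext (star_smul c z.1)
  have hstar_one : star (1 : algCrossedProduct α X hX) = 1 := Subtype.ext (star_one _)
  have hstar_star : ∀ z : algCrossedProduct α X hX, star (star z) = z :=
    fun z => Subtype.ext (star_star z.1)
  refine ⟨fun z => le_max_of_le_left (apply_nonneg N.toSeminorm _), fun z w => ?_, fun c z => ?_,
    fun c => ?_, fun z => ?_⟩
  · rw [hstar_add]
    exact max_le ((hadd _ _).trans (add_le_add (le_max_left _ _) (le_max_left _ _)))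
      ((hadd _ _).trans (add_le_add (le_max_right _ _) (le_max_right _ _)))
  · rw [hstar_smul, hsmul, hsmul, norm_star, mul_max_of_nonneg _ _ (norm_nonneg c)]
  · rw [hstar_smul, hstar_one, hsmul, hsmul, hone, mul_zero, mul_zero, max_self]
  · rw [hstar_star, max_comm]

/-- The seminorms of the individual coefficients are bounded by the horizontal seminorm. -/
theorem apply_coeff_le (hLX : IsSlipNorm LX) (z : algCrossedProduct α X hX) (g : Γ) :
    LX ⟨coeff α g z.1, coeff_mem α g z⟩ * N.toSeminorm (Finsupp.single g 1)
      ≤ horizontalSeminorm α N LX z := by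
  classical
  have h : N.toSeminorm (Finsupp.single g (LX ⟨coeff α g z.1, coeff_mem α g z⟩ : ℂ))
      ≤ horizontalSeminorm α N LX z := by
    refine N.mono _ _ fun s => ?_
    rw [coeffSeminorm_apply α hLX, Finsupp.single_apply]
    split_ifs with hs
    · subst hs
      exact ⟨Complex.zero_le_real.2 (hLX.nonneg _), le_rfl⟩
    · exact ⟨le_rfl, Complex.zero_le_real.2 (hLX.nonneg _)⟩
  have h1 : (Finsupp.single g (LX ⟨coeff α g z.1, coeff_mem α g z⟩ : ℂ) : Γ →₀ ℂ)
      = (LX ⟨coeff α g z.1, coeff_mem α g z⟩ : ℂ) • Finsupp.single g 1 := by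
    rw [Finsupp.smul_single, smul_eq_mul, mul_one]
  rwa [h1, map_smul_eq_mul, Complex.norm_real, Real.norm_of_nonneg (hLX.nonneg _)] at h

theorem OrderPreservingNorm.single_pos (g : Γ) : 0 < N.toSeminorm (Finsupp.single g 1) := by
  refine lt_of_le_of_ne (apply_nonneg _ _) fun h => ?_
  have h1 := N.eq_zero_of_map_eq_zero _ h.symm
  simp at h1

end Horizontal

/-! ### Finite nets in the algebraic crossed product -/

/-- The operator `∑ (1 - φ(g)) x_g λ_g`, for a finitely supported `φ` which approximates the
trivial state of the group algebra, is small: its value at a norming functional `η` is the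
difference of the two states at `∑ η(x_g λ_g) λ_g`. -/
theorem norm_sub_multiplier_le {L : groupAlgebra Γ → ℝ}
    (hL : ∀ f, L f = diracSeminorm l f.1.toOp) (hl : IsMatrixLength l) {φ : Γ →₀ ℂ} {ε : ℝ}
    (hφ : ∀ (S : Finset Γ) (c : Γ → ℂ), L (∑ g ∈ S, groupElem (c g) g) ≤ 1 →
      ‖∑ g ∈ S, (1 - φ g) * c g‖ ≤ ε)
    (z : algCrossedProduct α X hX) (hz : diracSeminorm l z.1.toOp ≤ 1) :
    ‖∑ g ∈ (finite_coeff α z).toFinset, (1 - φ g) • gen α (coeff α g z.1) g‖ ≤ ε := by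
  set S := (finite_coeff α z).toFinset
  let w : Adjointable Aᵐᵒᵖ (L2 Γ A) := ∑ g ∈ S, (1 - φ g) • crossedGen α (coeff α g z.1) g
  have hw : (∑ g ∈ S, (1 - φ g) • gen α (coeff α g z.1) g).toOp = w := toOp_sum α _ _
  obtain ⟨η, hη1, hη2⟩ := exists_dual_vector'' ℂ w
  have hop : (∑ g ∈ S, groupElem (η (crossedGen α (coeff α g z.1) g)) g).1.toOp
      = ∑ g ∈ S, crossedGen (trivialAction Γ) (η (crossedGen α (coeff α g z.1) g)) g := by
    rw [AddSubmonoidClass.coe_finsetSum, toOp_sum]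
    rfl
  have hcomm := IsDiracCommutator.sum S fun g _ => isDiracCommutator_commOp (trivialAction Γ) hl
    (η (crossedGen α (coeff α g z.1) g)) g
  have hle : L (∑ g ∈ S, groupElem (η (crossedGen α (coeff α g z.1) g)) g) ≤ 1 := by
    rw [hL, hop, diracSeminorm_eq_norm hcomm]
    refine (norm_sum_commOp_slice_le α hl S (fun g => coeff α g z.1) η hη1).trans ?_
    rwa [diracSeminorm_eq α hl] at hz
  have h := hφ S _ hle
  have hηw : η w = ∑ g ∈ S, (1 - φ g) * η (crossedGen α (coeff α g z.1) g) := by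
    simp only [w, map_sum, map_smul, smul_eq_mul]
  rw [← hηw, hη2] at h
  change ‖(∑ g ∈ S, (1 - φ g) • gen α (coeff α g z.1) g).toOp‖ ≤ ε
  rw [hw]
  simpa using h

/-- The version of `exists_finite_net` for the set `{x : L x ≤ C}`. -/
theorem exists_finite_net_of_le {B : Type*} [CStarAlgebra B] {Y : OperatorSystem B} {L : Y → ℝ}
    (h : IsCompactQuantumMetricSpace Y L) (C : ℝ) {ε : ℝ} (hε : 0 < ε) :
    ∃ F : Set Y, F.Finite ∧
      ∀ x, L x ≤ C → ∃ y ∈ F, ∃ c : ℂ, ‖(x : B) - y - c • (1 : B)‖ ≤ ε := by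
  set D : ℝ := max C 1
  have hD : 0 < D := lt_max_of_lt_right one_pos
  have hD0 : (D : ℂ) ≠ 0 := Complex.ofReal_ne_zero.2 hD.ne'
  obtain ⟨F, hF, hnet⟩ := OperatorSystem.exists_finite_net h (div_pos hε hD)
  refine ⟨(fun y => (D : ℂ) • y) '' F, hF.image _, fun x hx => ?_⟩
  obtain ⟨y, hy, c, hc⟩ := hnet ((D : ℂ)⁻¹ • x) (by
    rw [h.isSlipNorm.smul, norm_inv, Complex.norm_real, Real.norm_of_nonneg hD.le,
      inv_mul_le_one₀ hD]
    exact hx.trans (le_max_left _ _))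
  refine ⟨_, ⟨y, hy, rfl⟩, D * c, ?_⟩
  have h1 : (x : B) - ((D : ℂ) • y : Y) - (D * c : ℂ) • (1 : B)
      = (D : ℂ) • ((((D : ℂ)⁻¹ • x : Y) : B) - y - c • (1 : B)) := by
    rw [Submodule.coe_smul, Submodule.coe_smul, smul_sub, smul_sub, smul_inv_smul₀ hD0, smul_smul]
  rw [h1, norm_smul, Complex.norm_real, Real.norm_of_nonneg hD.le]
  rwa [le_div_iff₀' hD] at hc

/-- In a compact quantum metric space, bounded sets on which the seminorm is bounded are totally
bounded. -/
theorem exists_finite_net_of_bounded {B : Type*} [CStarAlgebra B] [Nontrivial B]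
    {Y : OperatorSystem B} {L : Y → ℝ} (h : IsCompactQuantumMetricSpace Y L) (C R : ℝ) {ε : ℝ}
    (hε : 0 < ε) : ∃ F : Set Y, F.Finite ∧
      ∀ x, L x ≤ C → ‖(x : B)‖ ≤ R → ∃ y ∈ F, ‖(x : B) - y‖ ≤ ε := by
  obtain ⟨F, hF, hnet⟩ := exists_finite_net_of_le h C (half_pos hε)
  obtain ⟨M, hM⟩ := (hF.image fun y : Y => ‖(y : B)‖).bddAbove
  obtain ⟨T, hT, hcover⟩ := Metric.totallyBounded_iff.1
    (isCompact_closedBall (0 : ℂ) (R + M + ε / 2)).totallyBounded (ε / 2) (half_pos hε)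
  refine ⟨Set.image2 (fun y c => y + c • (1 : Y)) F T, hF.image2 _ hT, fun x hx hxR => ?_⟩
  obtain ⟨y, hy, c, hc⟩ := hnet x hx
  have hyM : ‖(y : B)‖ ≤ M := hM ⟨y, hy, rfl⟩
  have hcb : ‖c‖ ≤ R + M + ε / 2 := by
    have h1 : c • (1 : B) = (x : B) - y - ((x : B) - y - c • (1 : B)) := by abel
    have h2 : ‖c‖ = ‖c • (1 : B)‖ := by rw [norm_smul, CStarRing.norm_one, mul_one]
    rw [h2, h1]
    have h3 := norm_sub_le ((x : B) - y) ((x : B) - y - c • (1 : B))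
    have h4 := norm_sub_le (x : B) y
    linarith
  obtain ⟨c', hc', hcc'⟩ := Set.mem_iUnion₂.1 (hcover (mem_closedBall_zero_iff.2 hcb))
  refine ⟨_, ⟨y, hy, c', hc', rfl⟩, ?_⟩
  have h1 : (x : B) - ((y + c' • (1 : Y) : Y) : B)
      = ((x : B) - y - c • (1 : B)) + (c - c') • (1 : B) := by
    rw [Submodule.coe_add, Submodule.coe_smul, OperatorSystem.coe_one, sub_smul]
    abel
  have h2 : ‖(c - c') • (1 : B)‖ ≤ ε / 2 := by
    rw [norm_smul, CStarRing.norm_one, mul_one, ← dist_eq_norm]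
    exact (Metric.mem_ball.1 hcc').le
  rw [h1]
  linarith [norm_add_le ((x : B) - y - c • (1 : B)) ((c - c') • (1 : B))]

/-- The seminorm of the crossed product is totally bounded on each coefficient, modulo scalars at
the unit of the group only. -/
theorem exists_finite_net_coeff [Nontrivial A] {n : ℕ} {l : Γ → Matrix (Fin n) (Fin n) ℂ}
    (hl : IsMatrixLength l) (N : OrderPreservingNorm Γ) {LX : X → ℝ}
    (hLX : IsCompactQuantumMetricSpace X LX) (g : Γ) {ε : ℝ} (hε : 0 < ε) :
    ∃ F : Set X, F.Finite ∧ ∀ z : algCrossedProduct α X hX, diracSeminorm l z.1.toOp ≤ 1 →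
      horizontalSeminorm α N LX z ≤ 1 → ∃ y ∈ F, ∃ c : ℂ, (g ≠ 1 → c = 0) ∧
        ‖coeff α g z.1 - y - c • (1 : A)‖ ≤ ε := by
  set C : ℝ := (N.toSeminorm (Finsupp.single g 1))⁻¹
  have hC : ∀ z : algCrossedProduct α X hX, horizontalSeminorm α N LX z ≤ 1 →
      LX ⟨coeff α g z.1, coeff_mem α g z⟩ ≤ C := fun z hz => by
    change _ ≤ (N.toSeminorm (Finsupp.single g 1))⁻¹
    rw [← one_div, le_div_iff₀ (N.single_pos g)]
    exact (apply_coeff_le α N hLX.isSlipNorm z g).trans hz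
  by_cases hg : g = 1
  · obtain ⟨F, hF, hnet⟩ := exists_finite_net_of_le hLX C hε
    refine ⟨F, hF, fun z _ hz => ?_⟩
    obtain ⟨y, hy, c, hc⟩ := hnet _ (hC z hz)
    exact ⟨y, hy, c, fun h => absurd hg h, hc⟩
  · obtain ⟨i, j, hij⟩ : ∃ i j, l g i j ≠ 0 := by
      by_contra! h
      exact hg ((hl.eq_zero_iff g).1 (Matrix.ext h))
    obtain ⟨F, hF, hnet⟩ := exists_finite_net_of_bounded hLX C ‖l g i j‖⁻¹ hε
    refine ⟨F, hF, fun z hz hz' => ?_⟩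
    obtain ⟨y, hy, hc⟩ := hnet _ (hC z hz') (by
      rw [← one_div, le_div_iff₀' (norm_pos_iff.2 hij)]
      exact (norm_coeff_mul_le α hl z g i j).trans hz)
    exact ⟨y, hy, 0, fun _ => rfl, by rwa [zero_smul, sub_zero]⟩

end AlgCrossedProduct

end

theorem theoremA {Γ : Type*} [Group Γ] [Countable Γ] (hΓ : IsAmenable Γ)
    {n : ℕ} (l : Γ → Matrix (Fin n) (Fin n) ℂ) (hl : IsMatrixLength l)
    (hl_proper : IsProperMatrixLength l)
    (N : OrderPreservingNorm Γ)
    {A : Type*} [CStarAlgebra A] [PartialOrder A] [StarOrderedRing A]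
    (α : Γ →* (A ≃⋆ₐ[ℂ] A))
    (X : OperatorSystem A) (hX : ∀ g, ∀ x ∈ X, α g x ∈ X)
    (LX : X → ℝ) (hLX : IsCompactQuantumMetricSpace X LX)
    (hLΓ : IsCompactQuantumMetricSpace (groupAlgebra Γ) fun z => diracSeminorm l z.1.toOp) :
    (∀ z : algCrossedProduct α X hX, ∃ d, IsDiracCommutator l z.1.toOp d) ∧
    IsCompactQuantumMetricSpace (algCrossedProduct α X hX) fun z =>
      max (diracSeminorm l z.1.toOp)
        (max (horizontalSeminorm α N LX z) (horizontalSeminorm α N LX (star z))) := by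
  classical
  refine ⟨fun z => ⟨_, isDiracCommutator_diracCommutator α hl z⟩, ?_⟩
  have hslip1 := isSlipNorm_diracSeminorm α (hX := hX) hl
  have hslip2 := isSlipNorm_horizontalSeminorm α (hX := hX) N hLX.isSlipNorm
  refine OperatorSystem.isCompactQuantumMetricSpace_of_finite_net
    ⟨fun z => le_max_of_le_left (hslip1.nonneg z), fun z w => ?_, fun c z => ?_, fun c => ?_,
      fun z => ?_⟩ fun ε hε => ?_
  · exact max_le ((hslip1.add_le z w).trans (add_le_add (le_max_left _ _) (le_max_left _ _)))
      ((hslip2.add_le z w).trans (add_le_add (le_max_right _ _) (le_max_right _ _)))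
  · rw [mul_max_of_nonneg _ _ (norm_nonneg c)]
    exact congrArg₂ max (hslip1.smul c z) (hslip2.smul c z)
  · exact (congrArg₂ max (hslip1.scalar c) (hslip2.scalar c)).trans (max_self 0)
  · exact congrArg₂ max (hslip1.star z) (hslip2.star z)
  rcases subsingleton_or_nontrivial A with hA | hA
  · refine ⟨{0}, Set.finite_singleton 0, fun z _ => ⟨0, rfl, 0, ?_⟩⟩
    have h0 : ∀ w : ReducedCrossedProduct α, w = 0 := fun w =>
      Subtype.ext (Adjointable.ext fun f => L2.ext fun t => Subsingleton.elim _ _)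
    rw [h0 (z.1 - _ - _), norm_zero]
    exact hε.le
  -- `φ` is the symbol of a multiplier with finite support; `F₀` contains `1` so that the scalar part
  -- of the coefficient at `1` is seen in the sum over `F₀`
  obtain ⟨φ, hφ1, hφ⟩ := hΓ.exists_finsupp_near_trivial hLΓ (half_pos hε)
  set F₀ : Finset Γ := insert 1 φ.support
  set M : ℝ := ∑ g ∈ F₀, ‖φ g‖ + 1
  have hM : 0 < M := by positivity
  choose F hF hnet using fun g =>
    exists_finite_net_coeff α (hX := hX) hl N hLX g (show 0 < ε / (2 * M) by positivity)
  let e : X → Γ → algCrossedProduct α X hX := fun x g =>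
    ⟨gen α x.1 g, Submodule.subset_span ⟨x.1, x.2, g, rfl⟩⟩
  refine ⟨(fun y : F₀ → X => ∑ g : F₀, φ g • e (y g) g) '' (Set.univ.pi fun g : F₀ => F g),
    (Set.Finite.pi fun g : F₀ => hF g).image _, fun z hz => ?_⟩
  have hz1 : diracSeminorm l z.1.toOp ≤ 1 := (le_max_left _ _).trans hz
  have hz2 : horizontalSeminorm α N LX z ≤ 1 :=
    (le_max_left _ _).trans ((le_max_right _ _).trans hz)
  choose y hyF c hc0 hc using fun g => hnet g z hz1 hz2
  refine ⟨_, ⟨fun g => y g, fun g _ => hyF g, rfl⟩, c 1, ?_⟩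
  set S := (finite_coeff α z).toFinset
  have hmult : ∑ g ∈ S, φ g • gen α (coeff α g z.1) g
      = ∑ g ∈ F₀, φ g • gen α (coeff α g z.1) g := by
    have h1 : ∑ g ∈ S, φ g • gen α (coeff α g z.1) g
        = ∑ g ∈ S ∪ F₀, φ g • gen α (coeff α g z.1) g := by
      refine Finset.sum_subset Finset.subset_union_left fun g _ hg => ?_
      have h0 : coeff α g z.1 = 0 := by simpa [S] using hg
      rw [h0, ← genLin_apply, map_zero, smul_zero]
    have h2 : ∑ g ∈ F₀, φ g • gen α (coeff α g z.1) g
        = ∑ g ∈ S ∪ F₀, φ g • gen α (coeff α g z.1) g := by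
      refine Finset.sum_subset Finset.subset_union_right fun g _ hg => ?_
      have h0 : φ g = 0 := by
        by_contra h
        exact hg (Finset.mem_insert_of_mem (Finsupp.mem_support_iff.2 h))
      rw [h0, zero_smul]
    rw [h1, h2]
  have hscalar : c 1 • (1 : ReducedCrossedProduct α)
      = ∑ g ∈ F₀, φ g • gen α (c g • (1 : A)) g := by
    rw [Finset.sum_eq_single_of_mem 1 (Finset.mem_insert_self _ _), hφ1, one_smul, ← genLin_apply,
      map_smul, genLin_apply, gen_one_one]
    intro g _ hg
    rw [hc0 g hg, zero_smul, ← genLin_apply, map_zero, smul_zero]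
  have hdecomp : z.1 - (∑ g : F₀, φ g • e (y g) g : algCrossedProduct α X hX).1
        - c 1 • (1 : ReducedCrossedProduct α)
      = ∑ g ∈ S, (1 - φ g) • gen α (coeff α g z.1) g
        + ∑ g ∈ F₀, φ g • gen α (coeff α g z.1 - y g - c g • (1 : A)) g := by
    have h1 : (∑ g : F₀, φ g • e (y g) g : algCrossedProduct α X hX).1
        = ∑ g ∈ F₀, φ g • gen α (y g).1 g := by
      rw [AddSubmonoidClass.coe_finsetSum, ← Finset.sum_coe_sort F₀]
      rfl
    simp only [← genLin_apply, map_sub, smul_sub, Finset.sum_sub_distrib, sub_smul, one_smul]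
    simp only [genLin_apply]
    rw [h1, hscalar, ← hmult, ← eq_sum_gen α z]
    abel
  rw [hdecomp]
  refine (norm_add_le _ _).trans ?_
  have h1 := norm_sub_multiplier_le α (fun _ => rfl) hl hφ z hz1
  have h2 : ‖∑ g ∈ F₀, φ g • gen α (coeff α g z.1 - y g - c g • (1 : A)) g‖ ≤ ε / 2 := by
    calc _ ≤ ∑ g ∈ F₀, ‖φ g‖ * (ε / (2 * M)) := by
          refine (norm_sum_le _ _).trans (Finset.sum_le_sum fun g _ => ?_)
          rw [norm_smul]
          exact mul_le_mul_of_nonneg_left ((norm_gen_le α _ g).trans (hc g)) (norm_nonneg _)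
      _ = (∑ g ∈ F₀, ‖φ g‖) * (ε / (2 * M)) := (Finset.sum_mul ..).symm
      _ ≤ M * (ε / (2 * M)) := by
          refine mul_le_mul_of_nonneg_right ?_ (by positivity)
          exact (lt_add_one _).le
      _ = ε / 2 := by
          field_simp
  linarith
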